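/- Let $t\ge 6$ and $n\ge 3t-6$ be integers, and let $M_t$ denote the matching of size $t$ (the disjoint union of $t$ edges). A plane triangulation is a finite simple graph drawn in the plane without crossings such that every face, including the outer face, is bounded by a triangle. The planar anti-Ramsey number $ar_{\mathcal P}(n,M_t)$ is the maximum number of colors used in an edge-coloring of a plane triangulation $T$ on $n$ vertices such that $T$ contains a subgraph isomorphic to $M_t$ but no rainbow copy of $M_t$, that is, no copy of $M_t$ whose edges all have different colors. This maximum exists, and $$2n+3t-15\;\le\; ar_{\mathcal P}(n,M_t)\;\le\; 2n+4t-14 .$$ -/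

import Mathlib

/-- The Euclidean plane, with its usual vector space structure and topology (only segments,
connectedness and frontiers are used, so the choice of norm is immaterial). -/
abbrev Plane : Type := ℝ × ℝ

/-- `S` is a polygonal arc with ends `a` and `b`: the union of the consecutive segments of a chain
`p 0 = a, p 1, …, p m = b` (`m ≥ 1`) that does not touch itself, that is, the segments are
nondegenerate, consecutive ones meet only in their common end, and others are disjoint. -/
def IsPolygonalArc (S : Set Plane) (a b : Plane) : Prop :=
  ∃ (m : ℕ) (p : ℕ → Plane), 1 ≤ m ∧ p 0 = a ∧ p m = b ∧
    (∀ i < m, p i ≠ p (i + 1)) ∧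
    (∀ i, i + 1 < m →
      segment ℝ (p i) (p (i + 1)) ∩ segment ℝ (p (i + 1)) (p (i + 2)) = {p (i + 1)}) ∧
    (∀ i j, i + 1 < j → j < m →
      Disjoint (segment ℝ (p i) (p (i + 1))) (segment ℝ (p j) (p (j + 1)))) ∧
    S = ⋃ i ∈ Set.Iio m, segment ℝ (p i) (p (i + 1))

/-- A drawing of the graph `G` in the plane without crossings: vertices are distinct points, each
edge is a polygonal arc joining its ends, an edge contains no vertex besides its ends, and two
edges meet only in common ends. A graph with such a drawing is a plane graph. -/
structure PlaneDrawing {V : Type*} (G : SimpleGraph V) where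
  point : V → Plane
  arc : G.edgeSet → Set Plane
  point_injective : Function.Injective point
  isPolygonalArc : ∀ (u v : V) (h : G.Adj u v),
    IsPolygonalArc (arc ⟨s(u, v), h⟩) (point u) (point v)
  mem_of_point_mem_arc : ∀ (e : G.edgeSet) (x : V), point x ∈ arc e → x ∈ e.1
  common_end_of_mem_arcs : ∀ (e f : G.edgeSet), e ≠ f → ∀ q ∈ arc e ∩ arc f,
    ∃ x : V, x ∈ e.1 ∧ x ∈ f.1 ∧ q = point x

namespace PlaneDrawing

variable {V : Type*} {G : SimpleGraph V}

/-- The point set of the drawn graph: all vertices and all edges. -/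
def carrier (D : PlaneDrawing G) : Set Plane :=
  Set.range D.point ∪ ⋃ e, D.arc e

/-- The faces are the connected components of the complement of the drawn graph. -/
def IsFace (D : PlaneDrawing G) (F : Set Plane) : Prop :=
  ∃ q ∈ D.carrierᶜ, F = connectedComponentIn D.carrierᶜ q

/-- Every face, the outer one included, is bounded by a triangle of the graph. -/
def IsTriangulation (D : PlaneDrawing G) : Prop :=
  ∀ F, D.IsFace F → ∃ (x y z : V) (hxy : G.Adj x y) (hyz : G.Adj y z) (hxz : G.Adj x z),
    frontier F = D.arc ⟨s(x, y), hxy⟩ ∪ D.arc ⟨s(y, z), hyz⟩ ∪ D.arc ⟨s(x, z), hxz⟩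

end PlaneDrawing

/-- A plane triangulation on `n` vertices. -/
structure PlaneTriangulation (n : ℕ) where
  graph : SimpleGraph (Fin n)
  drawing : PlaneDrawing graph
  isTriangulation : drawing.IsTriangulation

/-- `M_t`, the matching of size `t`: the disjoint union of `t` edges. -/
def matchingGraph (t : ℕ) : SimpleGraph (Fin t × Bool) where
  Adj a b := a.1 = b.1 ∧ a.2 ≠ b.2
  symm := ⟨fun _ _ h => ⟨h.1.symm, h.2.symm⟩⟩
  loopless := ⟨fun _ h => h.2 rfl⟩

/-- The edge-coloured graph `G` contains a copy of `H` all of whose edges have different colours. -/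
def HasRainbowCopy {V W K : Type*} (H : SimpleGraph W) {G : SimpleGraph V}
    (c : G.EdgeLabeling K) : Prop :=
  ∃ f : SimpleGraph.Copy H G, Function.Injective fun e : H.edgeSet => c (f.toHom.mapEdgeSet e)

/-- The numbers `k` such that some plane triangulation on `n` vertices containing `H` has an
edge-colouring with exactly `k` colours and without a rainbow copy of `H`. -/
def planarAntiRamseyColors {W : Type*} (n : ℕ) (H : SimpleGraph W) : Set ℕ :=
  {k | ∃ T : PlaneTriangulation n, H.IsContained T.graph ∧
    ∃ c : T.graph.EdgeLabeling (Fin k), Function.Surjective c ∧ ¬ HasRainbowCopy H c}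

/-- The planar anti-Ramsey number of `H`: the maximum of these numbers. -/
noncomputable def planarAntiRamsey {W : Type*} (n : ℕ) (H : SimpleGraph W) : ℕ :=
  sSup (planarAntiRamseyColors n H)

/-!
The maximum exists once the set of admissible numbers of colours is shown to be nonempty and
bounded, so the theorem consists of an upper and a lower bound.

**Upper bound.** Choose one edge of each colour. Without a rainbow `M_t`, the chosen edges form a
plane graph on the `n` vertices without `t` disjoint edges, and
`PlaneDrawing.card_edgeFinset_add_le_of_not_isContained` bounds its number of edges by
`2n + 4t - 14`: take a maximum matching, apply `E ≤ 3V - 6` to its vertex set and `E ≤ 2V - 4` to the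
bipartite graph between one end of each matching edge and the unmatched vertices; augmenting paths
show that only few further edges exist.

The two inequalities for plane graphs follow from the half `E + 2 ≤ V + F` of Euler's formula
(`SimpleGraph.FaceTracing.card_edgeSet_add_two_le`), where `F` counts the orbits of the permutation
of the darts that follows the faces. This needs only that every cycle modulo two is the boundary of
a set of such orbits. To see this, shear the polygonal drawing until no segment is vertical and
colour a point by the parity of the number of segments of the cycle on the upward vertical ray from
it (`SegmentSystem.rayParity`). The colour is constant along each side of a segment, and going
around a point it changes exactly at the segments of the cycle
(`SegmentSystem.IsEven.leftParity_eq`); so it is constant along each orbit and jumps across the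
edges of the cycle. Neither the Jordan curve theorem nor the topology of the faces is used.

**Lower bound.** Put `R = t - 5`. A triangulation is built by repeatedly placing a vertex inside a
triangular face and joining it to the vertices of the face (`StackedDrawing.exists_insert`). The
faces are chosen so that a set of `R + 3 = t - 2` vertices, the core, meets at least `2n + 3R - 1`
edges. Give these edges different colours and all other edges one further colour. Among `t`
disjoint edges at least two miss the core, so a copy of `M_t` is not rainbow.
-/

open Filter Topology

/-! ### Systems of segments and the parity of rays -/

/-- A family of non-vertical segments in the plane, the `j`-th one running from its left end
`left j` to its right end `right j`, any two of which meet only in common ends. -/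
structure SegmentSystem (J : Type*) where
  left : J → Plane
  right : J → Plane
  left_lt_right : ∀ j, (left j).1 < (right j).1
  common_end : ∀ j k, j ≠ k → ∀ q ∈ segment ℝ (left j) (right j) ∩ segment ℝ (left k) (right k),
    (q = left j ∨ q = right j) ∧ (q = left k ∨ q = right k)

namespace SegmentSystem

variable {J : Type*} (S : SegmentSystem J)

/-- The slope of the segment `j`. -/
noncomputable def slope (j : J) : ℝ :=
  ((S.right j).2 - (S.left j).2) / ((S.right j).1 - (S.left j).1)

/-- The ordinate at abscissa `x` of the line carrying the segment `j`. -/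
noncomputable def height (j : J) (x : ℝ) : ℝ :=
  (S.left j).2 + S.slope j * (x - (S.left j).1)

theorem height_left (j : J) : S.height j (S.left j).1 = (S.left j).2 := by simp [height]

theorem height_right (j : J) : S.height j (S.right j).1 = (S.right j).2 := by
  have h := S.left_lt_right j
  have h' : (S.right j).1 - (S.left j).1 ≠ 0 := by linarith
  simp only [height, slope]
  field_simp
  ring

theorem height_eq_add (j : J) (x₀ x : ℝ) :
    S.height j x = S.height j x₀ + S.slope j * (x - x₀) := by
  simp only [height]; ring

theorem continuous_height (j : J) : Continuous (S.height j) := by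
  unfold height; fun_prop

theorem mk_height_mem_segment (j : J) {x : ℝ} (h₁ : (S.left j).1 ≤ x) (h₂ : x ≤ (S.right j).1) :
    (x, S.height j x) ∈ segment ℝ (S.left j) (S.right j) := by
  have h := S.left_lt_right j
  have h' : (S.right j).1 - (S.left j).1 ≠ 0 := by linarith
  rw [segment_eq_image']
  refine ⟨(x - (S.left j).1) / ((S.right j).1 - (S.left j).1),
    ⟨div_nonneg (by linarith) (by linarith), (div_le_one (by linarith)).2 (by linarith)⟩, ?_⟩
  ext
  · simp; field_simp; ring
  · simp [height, slope]; field_simp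

/-- The ends of a segment are the only points of the system that a second segment can share with
it. -/
theorem eq_of_height_eq {j k : J} (hjk : j ≠ k) {x : ℝ}
    (hj₁ : (S.left j).1 ≤ x) (hj₂ : x ≤ (S.right j).1)
    (hk₁ : (S.left k).1 ≤ x) (hk₂ : x ≤ (S.right k).1) (h : S.height j x = S.height k x) :
    ((x, S.height j x) = S.left j ∨ (x, S.height j x) = S.right j) ∧
      ((x, S.height j x) = S.left k ∨ (x, S.height j x) = S.right k) :=
  S.common_end j k hjk _ ⟨S.mk_height_mem_segment j hj₁ hj₂,
    h ▸ S.mk_height_mem_segment k hk₁ hk₂⟩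

/-- A segment without its right end contains a given end of a segment only if it begins there. -/
theorem left_eq_iff {j : J} {q : Plane} (hq : q = S.left j ∨ q = S.right j) (k : J) :
    ((S.left k).1 ≤ q.1 ∧ q.1 < (S.right k).1 ∧ S.height k q.1 = q.2) ↔ S.left k = q := by
  constructor
  · rintro ⟨h₁, h₂, h₃⟩
    by_cases hjk : j = k
    · subst hjk
      rcases hq with hq | hq
      · exact hq.symm
      · rw [hq] at h₂; exact absurd h₂ (lt_irrefl _)
    · have hh : S.height j q.1 = q.2 := by
        rcases hq with hq | hq <;> rw [hq]
        exacts [S.height_left j, S.height_right j]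
      have hb : (S.left j).1 ≤ q.1 ∧ q.1 ≤ (S.right j).1 := by
        have := S.left_lt_right j
        rcases hq with hq | hq <;> rw [hq] <;> constructor <;> linarith
      have := (S.eq_of_height_eq hjk hb.1 hb.2 h₁ h₂.le (hh.trans h₃.symm)).2
      rw [hh] at this
      rcases this with h | h
      · exact h.symm
      · rw [← h] at h₂; exact absurd h₂ (lt_irrefl _)
  · rintro rfl
    exact ⟨le_rfl, S.left_lt_right k, S.height_left k⟩

/-- A segment without its left end contains a given end of a segment only if it ends there. -/
theorem right_eq_iff {j : J} {q : Plane} (hq : q = S.left j ∨ q = S.right j) (k : J) :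
    ((S.left k).1 < q.1 ∧ q.1 ≤ (S.right k).1 ∧ S.height k q.1 = q.2) ↔ S.right k = q := by
  constructor
  · rintro ⟨h₁, h₂, h₃⟩
    by_cases hjk : j = k
    · subst hjk
      rcases hq with hq | hq
      · rw [hq] at h₁; exact absurd h₁ (lt_irrefl _)
      · exact hq.symm
    · have hh : S.height j q.1 = q.2 := by
        rcases hq with hq | hq <;> rw [hq]
        exacts [S.height_left j, S.height_right j]
      have hb : (S.left j).1 ≤ q.1 ∧ q.1 ≤ (S.right j).1 := by
        have := S.left_lt_right j
        rcases hq with hq | hq <;> rw [hq] <;> constructor <;> linarith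
      have := (S.eq_of_height_eq hjk hb.1 hb.2 h₁.le h₂ (hh.trans h₃.symm)).2
      rw [hh] at this
      rcases this with h | h
      · rw [← h] at h₁; exact absurd h₁ (lt_irrefl _)
      · exact h.symm
  · rintro rfl
    exact ⟨S.left_lt_right k, le_rfl, S.height_right k⟩

theorem eq_of_left_eq_of_slope_eq {j k : J} (h : S.left j = S.left k)
    (hs : S.slope j = S.slope k) : j = k := by
  by_contra hjk
  have hj := S.left_lt_right j
  have hk := S.left_lt_right k
  -- halfway to the nearer right end the segments share a point that is an end of neither
  set r := min (S.right j).1 (S.right k).1 with hr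
  have hr₁ : r ≤ (S.right j).1 := min_le_left _ _
  have hr₂ : r ≤ (S.right k).1 := min_le_right _ _
  have hr₃ : (S.left j).1 < r := lt_min hj (h ▸ hk)
  have hx : ((S.left j).1 + r) / 2 < r := by linarith
  have hx' : (S.left j).1 < ((S.left j).1 + r) / 2 := by linarith
  have := (S.eq_of_height_eq hjk (x := ((S.left j).1 + r) / 2) hx'.le (by linarith)
    (by rw [← h]; linarith) (by linarith) (by simp only [height, hs, h])).1
  rcases this with e | e
  · have := congrArg Prod.fst e; simp only at this; linarith
  · have := congrArg Prod.fst e; simp only at this; linarith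

theorem eq_of_right_eq_of_slope_eq {j k : J} (h : S.right j = S.right k)
    (hs : S.slope j = S.slope k) : j = k := by
  by_contra hjk
  have hj := S.left_lt_right j
  have hk := S.left_lt_right k
  set r := max (S.left j).1 (S.left k).1 with hr
  have hr₁ : (S.left j).1 ≤ r := le_max_left _ _
  have hr₂ : (S.left k).1 ≤ r := le_max_right _ _
  have hr₃ : r < (S.right j).1 := max_lt hj (h ▸ hk)
  have hx : r < ((S.right j).1 + r) / 2 := by linarith
  have hx' : ((S.right j).1 + r) / 2 < (S.right j).1 := by linarith
  have := (S.eq_of_height_eq hjk (x := ((S.right j).1 + r) / 2) (by linarith) hx'.le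
    (by linarith) (by rw [← h]; linarith) (by
      rw [S.height_eq_add j (S.right j).1, S.height_eq_add k (S.right j).1, height_right, hs, h,
        height_right])).1
  rcases this with e | e
  · have := congrArg Prod.fst e; simp only at this; linarith
  · have := congrArg Prod.fst e; simp only at this; linarith

section Parity

variable [Fintype J] (z : J → ZMod 2)

open Classical in
/-- The parity, with weights `z`, of the number of segments met by the upward vertical ray from the
point of abscissa `x` on the segment `j`; a segment counts over its left end but not over its right
end. -/
noncomputable def rayParity (j : J) (x : ℝ) : ZMod 2 :=
  ∑ k, if (S.left k).1 ≤ x ∧ x < (S.right k).1 ∧ S.height j x < S.height k x then z k else 0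

open Classical in
/-- Just to the right of `x₀`, a segment through the point at `x₀` is above the segment `j` if it is
steeper. -/
theorem eventually_rayParity_right (j : J) (x₀ : ℝ) :
    ∀ᶠ x in 𝓝[>] x₀, S.rayParity z j x = ∑ k, if (S.left k).1 ≤ x₀ ∧ x₀ < (S.right k).1 ∧
      (S.height j x₀ < S.height k x₀ ∨ S.height k x₀ = S.height j x₀ ∧ S.slope j < S.slope k)
      then z k else 0 := by
  have key : ∀ k, ∀ᶠ x in 𝓝[>] x₀,
      (((S.left k).1 ≤ x ∧ x < (S.right k).1 ∧ S.height j x < S.height k x) ↔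
      ((S.left k).1 ≤ x₀ ∧ x₀ < (S.right k).1 ∧
      (S.height j x₀ < S.height k x₀ ∨
        S.height k x₀ = S.height j x₀ ∧ S.slope j < S.slope k))) := by
    intro k
    rcases lt_or_ge x₀ (S.left k).1 with h₁ | h₁
    · filter_upwards [nhdsWithin_le_nhds (Iio_mem_nhds h₁)] with x hx
      simp only [Set.mem_Iio] at hx
      constructor <;> rintro ⟨h, -⟩ <;> linarith
    rcases le_or_gt (S.right k).1 x₀ with h₂ | h₂
    · filter_upwards [self_mem_nhdsWithin] with x hx
      simp only [Set.mem_Ioi] at hx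
      constructor <;> rintro ⟨-, h, -⟩ <;> linarith
    rcases lt_trichotomy (S.height j x₀) (S.height k x₀) with h₃ | h₃ | h₃
    · filter_upwards [self_mem_nhdsWithin, nhdsWithin_le_nhds (Iio_mem_nhds h₂),
        nhdsWithin_le_nhds ((S.continuous_height j).continuousAt.eventually_lt
          (S.continuous_height k).continuousAt h₃)] with x hx hx₂ hx₃
      simp only [Set.mem_Ioi, Set.mem_Iio] at hx hx₂
      exact ⟨fun _ => ⟨h₁, h₂, .inl h₃⟩, fun _ => ⟨h₁.trans hx.le, hx₂, hx₃⟩⟩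
    · filter_upwards [self_mem_nhdsWithin, nhdsWithin_le_nhds (Iio_mem_nhds h₂)] with x hx hx₂
      simp only [Set.mem_Ioi, Set.mem_Iio] at hx hx₂
      rw [S.height_eq_add j x₀ x, S.height_eq_add k x₀ x, h₃]
      have : S.slope j * (x - x₀) < S.slope k * (x - x₀) ↔ S.slope j < S.slope k :=
        mul_lt_mul_iff_of_pos_right (by linarith)
      simp only [add_lt_add_iff_left, this, lt_irrefl, true_and, false_or, h₁, h₂, hx₂,
        h₁.trans hx.le]
    · filter_upwards [nhdsWithin_le_nhds ((S.continuous_height k).continuousAt.eventually_lt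
          (S.continuous_height j).continuousAt h₃)] with x hx
      constructor
      · rintro ⟨-, -, h⟩; linarith
      · rintro ⟨-, -, h | h⟩ <;> linarith
  filter_upwards [Filter.eventually_all.2 key] with x hx
  exact Finset.sum_congr rfl fun k _ => if_congr (hx k) rfl rfl

open Classical in
/-- Just to the left of `x₀`, a segment through the point at `x₀` is above the segment `j` if it is
less steep. -/
theorem eventually_rayParity_left (j : J) (x₀ : ℝ) :
    ∀ᶠ x in 𝓝[<] x₀, S.rayParity z j x = ∑ k, if (S.left k).1 < x₀ ∧ x₀ ≤ (S.right k).1 ∧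
      (S.height j x₀ < S.height k x₀ ∨ S.height k x₀ = S.height j x₀ ∧ S.slope k < S.slope j)
      then z k else 0 := by
  have key : ∀ k, ∀ᶠ x in 𝓝[<] x₀,
      (((S.left k).1 ≤ x ∧ x < (S.right k).1 ∧ S.height j x < S.height k x) ↔
      ((S.left k).1 < x₀ ∧ x₀ ≤ (S.right k).1 ∧
      (S.height j x₀ < S.height k x₀ ∨
        S.height k x₀ = S.height j x₀ ∧ S.slope k < S.slope j))) := by
    intro k
    rcases lt_or_ge (S.right k).1 x₀ with h₁ | h₁
    · filter_upwards [nhdsWithin_le_nhds (Ioi_mem_nhds h₁)] with x hx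
      simp only [Set.mem_Ioi] at hx
      constructor <;> rintro ⟨-, h, -⟩ <;> linarith
    rcases le_or_gt x₀ (S.left k).1 with h₂ | h₂
    · filter_upwards [self_mem_nhdsWithin] with x hx
      simp only [Set.mem_Iio] at hx
      constructor <;> rintro ⟨h, -⟩ <;> linarith
    rcases lt_trichotomy (S.height j x₀) (S.height k x₀) with h₃ | h₃ | h₃
    · filter_upwards [self_mem_nhdsWithin, nhdsWithin_le_nhds (Ioi_mem_nhds h₂),
        nhdsWithin_le_nhds ((S.continuous_height j).continuousAt.eventually_lt
          (S.continuous_height k).continuousAt h₃)] with x hx hx₂ hx₃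
      simp only [Set.mem_Ioi, Set.mem_Iio] at hx hx₂
      exact ⟨fun _ => ⟨h₂, h₁, .inl h₃⟩, fun _ => ⟨hx₂.le, hx.trans_le h₁, hx₃⟩⟩
    · filter_upwards [self_mem_nhdsWithin, nhdsWithin_le_nhds (Ioi_mem_nhds h₂)] with x hx hx₂
      simp only [Set.mem_Ioi, Set.mem_Iio] at hx hx₂
      rw [S.height_eq_add j x₀ x, S.height_eq_add k x₀ x, h₃]
      have : S.slope j * (x - x₀) < S.slope k * (x - x₀) ↔ S.slope k < S.slope j :=
        mul_lt_mul_right_of_neg (by linarith)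
      simp only [add_lt_add_iff_left, this, lt_irrefl, true_and, false_or, h₁, h₂, hx₂.le,
        hx.trans_le h₁]
    · filter_upwards [nhdsWithin_le_nhds ((S.continuous_height k).continuousAt.eventually_lt
          (S.continuous_height j).continuousAt h₃)] with x hx
      constructor
      · rintro ⟨-, -, h⟩; linarith
      · rintro ⟨-, -, h | h⟩ <;> linarith
  filter_upwards [Filter.eventually_all.2 key] with x hx
  exact Finset.sum_congr rfl fun k _ => if_congr (hx k) rfl rfl

open Classical in
/-- The weights `z` form a cycle modulo two: their sum over the segments at any point vanishes. -/
def IsEven : Prop :=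
  ∀ q : Plane, ∑ k, ((if S.left k = q then z k else 0) + if S.right k = q then z k else 0) = 0

variable {z}

open Classical in
/-- For an even weight, the upward ray from a point meets as many segments just to the right of it
as just to the left, up to parity: the segments that begin or end on the ray do so at points where
the weights sum to zero. -/
theorem IsEven.sum_right_eq_sum_left (hz : S.IsEven z) (x₀ y₀ : ℝ) :
    (∑ k, if (S.left k).1 ≤ x₀ ∧ x₀ < (S.right k).1 ∧ y₀ < S.height k x₀ then z k else 0) =
      ∑ k, if (S.left k).1 < x₀ ∧ x₀ ≤ (S.right k).1 ∧ y₀ < S.height k x₀ then z k else 0 := by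
  rw [← CharTwo.add_eq_zero, ← Finset.sum_add_distrib]
  set Q : Finset Plane := (Finset.univ.image S.left ∪ Finset.univ.image S.right).filter
    fun q => q.1 = x₀ ∧ y₀ < q.2 with hQ
  have h0 : ∑ q ∈ Q, ∑ k, ((if S.left k = q then z k else 0) +
      if S.right k = q then z k else 0) = 0 := Finset.sum_eq_zero fun q _ => hz q
  rw [Finset.sum_comm] at h0
  refine Eq.trans ?_ h0
  refine Finset.sum_congr rfl fun k _ => ?_
  rw [Finset.sum_add_distrib, Finset.sum_ite_eq, Finset.sum_ite_eq]
  have hl : S.left k ∈ Q ↔ (S.left k).1 = x₀ ∧ y₀ < (S.left k).2 := by simp [hQ]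
  have hr : S.right k ∈ Q ↔ (S.right k).1 = x₀ ∧ y₀ < (S.right k).2 := by simp [hQ]
  rw [if_congr hl rfl rfl, if_congr hr rfl rfl]
  have hlt := S.left_lt_right k
  rcases eq_or_ne (S.left k).1 x₀ with h₁ | h₁
  · have h₂ : (S.right k).1 ≠ x₀ := by rw [← h₁]; exact hlt.ne'
    subst h₁
    simp [hlt, h₂, S.height_left k]
  · rcases eq_or_ne (S.right k).1 x₀ with h₂ | h₂
    · subst h₂
      simp [hlt, h₁, S.height_right k]
    · have h₃ : (S.left k).1 ≤ x₀ ↔ (S.left k).1 < x₀ := ⟨fun h => lt_of_le_of_ne h h₁, le_of_lt⟩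
      have h₄ : x₀ ≤ (S.right k).1 ↔ x₀ < (S.right k).1 :=
        ⟨fun h => lt_of_le_of_ne h h₂.symm, le_of_lt⟩
      simp only [h₁, h₂, h₃, h₄, false_and, if_false, add_zero]
      exact CharTwo.add_self_eq_zero _

/-- The ray parity is locally constant on the interior of a segment, since
no other segment meets it. -/
theorem IsEven.eventually_rayParity_eq (hz : S.IsEven z) (j : J) {x₀ : ℝ}
    (h₁ : (S.left j).1 < x₀) (h₂ : x₀ < (S.right j).1) :
    ∀ᶠ x in 𝓝 x₀, S.rayParity z j x = S.rayParity z j x₀ := by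
  classical
  have hne : ∀ k, (S.left k).1 ≤ x₀ → x₀ ≤ (S.right k).1 → S.height k x₀ = S.height j x₀ →
      S.slope j = S.slope k := by
    intro k hk₁ hk₂ hk
    by_contra hjk
    have hjk' : j ≠ k := fun h => hjk (h ▸ rfl)
    rcases (S.eq_of_height_eq hjk' h₁.le h₂.le hk₁ hk₂ hk.symm).1 with e | e
    · have := congrArg Prod.fst e; simp only at this; linarith
    · have := congrArg Prod.fst e; simp only at this; linarith
  rw [← nhdsNE_sup_pure, ← nhdsLT_sup_nhdsGT]
  simp only [Filter.eventually_sup, Filter.eventually_pure, and_true]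
  have hr : S.rayParity z j x₀ = ∑ k, if (S.left k).1 ≤ x₀ ∧ x₀ < (S.right k).1 ∧
      (S.height j x₀ < S.height k x₀ ∨ S.height k x₀ = S.height j x₀ ∧ S.slope j < S.slope k)
      then z k else 0 := by
    refine Finset.sum_congr rfl fun k _ => if_congr ⟨?_, ?_⟩ rfl rfl
    · rintro ⟨a, b, c⟩; exact ⟨a, b, .inl c⟩
    · rintro ⟨a, b, c | ⟨c, d⟩⟩
      · exact ⟨a, b, c⟩
      · exact absurd (hne k a b.le c) d.ne
  have hl : S.rayParity z j x₀ = ∑ k, if (S.left k).1 < x₀ ∧ x₀ ≤ (S.right k).1 ∧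
      (S.height j x₀ < S.height k x₀ ∨ S.height k x₀ = S.height j x₀ ∧ S.slope k < S.slope j)
      then z k else 0 := by
    rw [rayParity, hz.sum_right_eq_sum_left]
    refine Finset.sum_congr rfl fun k _ => if_congr ⟨?_, ?_⟩ rfl rfl
    · rintro ⟨a, b, c⟩; exact ⟨a, b, .inl c⟩
    · rintro ⟨a, b, c | ⟨c, d⟩⟩
      · exact ⟨a, b, c⟩
      · exact absurd (hne k a.le b c) d.ne'
  constructor
  · rw [hl]; exact S.eventually_rayParity_left z j x₀
  · rw [hr]; exact S.eventually_rayParity_right z j x₀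

theorem IsEven.rayParity_eq (hz : S.IsEven z) (j : J) {x y : ℝ}
    (hx : x ∈ Set.Ioo (S.left j).1 (S.right j).1) (hy : y ∈ Set.Ioo (S.left j).1 (S.right j).1) :
    S.rayParity z j x = S.rayParity z j y := by
  refine isPreconnected_Ioo.constant (f := S.rayParity z j) ?_ hx hy
  intro w hw
  exact (tendsto_nhds_of_eventually_eq
    (hz.eventually_rayParity_eq S j hw.1 hw.2)).mono_left nhdsWithin_le_nhds

variable (z)

/-- The common value of the ray parity on the interior of the segment `j`, that is, the value
just above the segment of the two-colouring of the plane that the cycle `z` defines. -/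
noncomputable def parityAbove (j : J) : ZMod 2 :=
  S.rayParity z j (((S.left j).1 + (S.right j).1) / 2)

variable {z}

open Classical in
/-- The parity above a segment, read off at its left end. -/
theorem IsEven.parityAbove_eq_of_left (hz : S.IsEven z) (j : J) :
    S.parityAbove z j = ∑ k, if (S.left k).1 ≤ (S.left j).1 ∧ (S.left j).1 < (S.right k).1 ∧
      ((S.left j).2 < S.height k (S.left j).1 ∨
        S.height k (S.left j).1 = (S.left j).2 ∧ S.slope j < S.slope k) then z k else 0 := by
  have hlt := S.left_lt_right j
  obtain ⟨x, hx, hx'⟩ := ((S.eventually_rayParity_right z j (S.left j).1).and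
    (Ioo_mem_nhdsGT hlt)).exists
  rw [S.height_left] at hx
  rw [← hx]
  exact hz.rayParity_eq S j ⟨by linarith, by linarith⟩ hx'

open Classical in
/-- The parity above a segment, read off at its right end. -/
theorem IsEven.parityAbove_eq_of_right (hz : S.IsEven z) (j : J) :
    S.parityAbove z j = ∑ k, if (S.left k).1 < (S.right j).1 ∧ (S.right j).1 ≤ (S.right k).1 ∧
      ((S.right j).2 < S.height k (S.right j).1 ∨
        S.height k (S.right j).1 = (S.right j).2 ∧ S.slope k < S.slope j) then z k else 0 := by
  have hlt := S.left_lt_right j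
  obtain ⟨x, hx, hx'⟩ := ((S.eventually_rayParity_left z j (S.right j).1).and
    (Ioo_mem_nhdsLT hlt)).exists
  rw [S.height_right] at hx
  rw [← hx]
  exact hz.rayParity_eq S j ⟨by linarith, by linarith⟩ hx'

end Parity

/-! ### The colour on the left of an oriented segment -/

/-- An oriented segment is a pair `(j, o)`, where `o` is `true` if the segment `j` is traversed
leftwards; this is the point where it begins. -/
def source (δ : J × Bool) : Plane := if δ.2 then S.right δ.1 else S.left δ.1

/-- The order of these keys is the anticlockwise order of the oriented segments with a given source,
starting from the downward direction. -/
noncomputable def angleKey (δ : J × Bool) : Lex (Bool × ℝ) := toLex (δ.2, S.slope δ.1)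

theorem eq_of_source_eq_of_angleKey_eq {δ ε : J × Bool} (h : S.source δ = S.source ε)
    (h' : S.angleKey δ = S.angleKey ε) : δ = ε := by
  obtain ⟨j, o⟩ := δ
  obtain ⟨k, o'⟩ := ε
  obtain ⟨ho, hs⟩ := Prod.mk.inj (toLex.injective h')
  dsimp only at ho hs
  subst ho
  cases o
  · rw [S.eq_of_left_eq_of_slope_eq (by simpa [source] using h) hs]
  · rw [S.eq_of_right_eq_of_slope_eq (by simpa [source] using h) hs]

variable [Fintype J] (z : J → ZMod 2)

/-- The value, on the left side of an oriented segment, of the two-colouring of the plane that the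
cycle `z` defines. -/
noncomputable def leftParity (δ : J × Bool) : ZMod 2 :=
  S.parityAbove z δ.1 + if δ.2 then z δ.1 else 0

theorem leftParity_add_leftParity_not (j : J) (o : Bool) :
    S.leftParity z (j, o) + S.leftParity z (j, !o) = z j := by
  have := CharTwo.add_self_eq_zero (S.parityAbove z j)
  cases o <;> simp only [leftParity, Bool.not_true, Bool.not_false, if_true, Bool.false_eq_true,
    if_false] <;> linear_combination this

open Classical in
/-- The value just below the point `q`: the segments over `q`, those through `q` included, count. -/
noncomputable def parityBelow (q : Plane) : ZMod 2 :=
  ∑ k, if (S.left k).1 ≤ q.1 ∧ q.1 < (S.right k).1 ∧ q.2 ≤ S.height k q.1 then z k else 0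

variable {z}

open Classical in
/-- Going anticlockwise around a point from the downward direction, the colour changes at each
segment that is passed, by the weight of this segment. -/
theorem IsEven.leftParity_eq (hz : S.IsEven z) (δ : J × Bool) :
    S.leftParity z δ = S.parityBelow z (S.source δ) +
      ∑ ε, if S.source ε = S.source δ ∧ S.angleKey ε ≤ S.angleKey δ then z ε.1 else 0 := by
  obtain ⟨j, o⟩ := δ
  rw [Fintype.sum_prod_type]
  simp only [Fintype.sum_bool]
  cases o
  · have hq : S.left j = S.left j ∨ S.left j = S.right j := .inl rfl
    simp only [leftParity, source, angleKey, Bool.false_eq_true, if_false, if_true, add_zero,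
      Prod.Lex.toLex_le_toLex, lt_irrefl, false_or, true_and, parityBelow]
    rw [hz.parityAbove_eq_of_left, ← Finset.sum_add_distrib]
    refine Finset.sum_congr rfl fun k _ => ?_
    simp only [← S.left_eq_iff hq k]
    have h2 := CharTwo.add_self_eq_zero (z k)
    have hlt : ¬ ((true : Bool) < false) := by decide
    simp only [hlt, false_or, reduceCtorEq, false_and, and_false, if_false, zero_add]
    by_cases h₁ : (S.left k).1 ≤ (S.left j).1 <;> by_cases h₂ : (S.left j).1 < (S.right k).1 <;>
      simp only [h₁, h₂, true_and, false_and, and_false, if_false, add_zero]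
    rcases lt_trichotomy (S.left j).2 (S.height k (S.left j).1) with h | h | h
    · simp [h, h.le, h.ne']
    · rcases lt_or_ge (S.slope j) (S.slope k) with h' | h'
      · simp [← h, h']
      · simp [← h, h', h2]
    · simp [h.ne, h.not_gt, h]
  · have hq : S.right j = S.left j ∨ S.right j = S.right j := .inr rfl
    have hlt : ((false : Bool) < true) := by decide
    simp only [leftParity, source, angleKey, Bool.false_eq_true, if_false, if_true,
      Prod.Lex.toLex_le_toLex, lt_irrefl, false_or, true_and, parityBelow, hlt, true_or, and_true]
    have hz1 : (∑ k, if S.right k = S.right j ∧ S.slope k = S.slope j then z k else 0) = z j := by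
      rw [Finset.sum_eq_single j]
      · simp
      · intro k _ hk
        rw [if_neg]
        rintro ⟨h, h'⟩
        exact hk (S.eq_of_right_eq_of_slope_eq h h')
      · simp
    have hp := hz.sum_right_eq_sum_left S (S.right j).1 (S.right j).2
    rw [hz.parityAbove_eq_of_right, ← hz1]
    refine add_right_cancel (b := ∑ k, if (S.left k).1 ≤ (S.right j).1 ∧
      (S.right j).1 < (S.right k).1 ∧ (S.right j).2 < S.height k (S.right j).1 then z k else 0) ?_
    conv_rhs => rw [hp]
    simp only [← Finset.sum_add_distrib]
    refine Finset.sum_congr rfl fun k _ => ?_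
    have h2 := CharTwo.add_self_eq_zero (z k)
    simp only [← S.left_eq_iff hq k, ← S.right_eq_iff hq k]
    generalize S.height k (S.right j).1 = y
    generalize (S.right j).2 = y'
    have hy : y' < y ∧ y ≠ y' ∧ y' ≤ y ∨ ¬ y' < y ∧ y = y' ∧ y' ≤ y ∨
        ¬ y' < y ∧ y ≠ y' ∧ ¬ y' ≤ y := by
      rcases lt_trichotomy y' y with h | h | h
      · exact .inl ⟨h, h.ne', h.le⟩
      · exact .inr (.inl ⟨h.not_lt, h.symm, h.le⟩)
      · exact .inr (.inr ⟨h.not_gt, h.ne, h.not_ge⟩)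
    have hs : S.slope k < S.slope j ∧ S.slope k ≠ S.slope j ∧ S.slope k ≤ S.slope j ∨
        ¬ S.slope k < S.slope j ∧ S.slope k = S.slope j ∧ S.slope k ≤ S.slope j ∨
        ¬ S.slope k < S.slope j ∧ S.slope k ≠ S.slope j ∧ ¬ S.slope k ≤ S.slope j := by
      rcases lt_trichotomy (S.slope k) (S.slope j) with h | h | h
      · exact .inl ⟨h, h.ne, h.le⟩
      · exact .inr (.inl ⟨h.not_lt, h, h.le⟩)
      · exact .inr (.inr ⟨h.not_gt, h.ne', h.not_ge⟩)
    -- what remains is a truth table in the position of segment `k` relative to the point `q`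
    generalize S.slope k = s at hs ⊢
    generalize S.slope j = s' at hs ⊢
    by_cases h₁ : (S.left k).1 ≤ (S.right j).1 <;> by_cases h₂ : (S.right j).1 < (S.right k).1 <;>
    by_cases h₃ : (S.left k).1 < (S.right j).1 <;> by_cases h₄ : (S.right j).1 ≤ (S.right k).1 <;>
      simp only [h₁, h₂, h₃, h₄, true_and, false_and, and_false, if_false, add_zero] <;>
    rcases hy with h | h | h <;> rcases hs with h' | h' | h' <;>
    simp [h, h', h2]

open Classical in
/-- If the weights in the open angle that one sweeps anticlockwise from `δ` to `ε` sum to zero, then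
the left side of `δ` and the left side of the reverse of `ε` have the same colour. -/
theorem IsEven.leftParity_eq_of_sum_eq (hz : S.IsEven z) {δ ε : J × Bool}
    (h : S.source δ = S.source ε)
    (hs : (∑ ζ, if S.source ζ = S.source δ ∧ S.angleKey ζ ≤ S.angleKey δ then z ζ.1 else 0) =
      ∑ ζ, if S.source ζ = S.source ε ∧ S.angleKey ζ < S.angleKey ε then z ζ.1 else 0) :
    S.leftParity z δ = S.leftParity z (ε.1, !ε.2) := by
  have h1 : (∑ ζ, if S.source ζ = S.source ε ∧ S.angleKey ζ = S.angleKey ε then z ζ.1 else 0) =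
      z ε.1 := by
    rw [Finset.sum_eq_single ε]
    · simp
    · intro ζ _ hk
      rw [if_neg]
      rintro ⟨h, h'⟩
      exact hk (S.eq_of_source_eq_of_angleKey_eq h h')
    · simp
  have h2 := S.leftParity_add_leftParity_not z ε.1 ε.2
  have h4 : (∑ ζ, if S.source ζ = S.source ε ∧ S.angleKey ζ ≤ S.angleKey ε then z ζ.1 else 0) =
      (∑ ζ, if S.source ζ = S.source ε ∧ S.angleKey ζ < S.angleKey ε then z ζ.1 else 0) +
      z ε.1 := by
    rw [← h1, ← Finset.sum_add_distrib]
    refine Finset.sum_congr rfl fun ζ _ => ?_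
    by_cases hζ : S.source ζ = S.source ε
    · rcases lt_trichotomy (S.angleKey ζ) (S.angleKey ε) with h' | h' | h'
      · simp [hζ, h', h'.le, h'.ne]
      · simp [hζ, h']
      · simp [hζ, h'.not_ge, h'.ne', h'.not_gt]
    · simp [hζ]
  have h5 := hz.leftParity_eq S δ
  have h6 := hz.leftParity_eq S ε
  rw [hs, h] at h5
  rw [h4] at h6
  have h7 := CharTwo.add_self_eq_zero (S.leftParity z (ε.1, !ε.2))
  change S.leftParity z ε + _ = _ at h2
  linear_combination h5 - h6 + h2 - h7

end SegmentSystem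

/-! ### Face tracings and half of Euler's formula -/

open Classical in
/-- The cyclic order that a linear order induces on a finite set, in terms of the partial sums of a
function with total sum zero. -/
theorem exists_cyclic_successor {α Λ : Type*} [Fintype α] [LinearOrder Λ] {f : α → Λ}
    (hf : Function.Injective f) (hα : 2 ≤ Fintype.card α) :
    ∃ σ : Equiv.Perm α, (∀ a, σ a ≠ a) ∧ ∀ z : α → ZMod 2, ∑ b, z b = 0 → ∀ a,
      (∑ b, if f b ≤ f a then z b else 0) = ∑ b, if f b < f (σ a) then z b else 0 := by
  obtain ⟨n, hn⟩ : ∃ n, Fintype.card α = n + 2 := ⟨_, (Nat.sub_add_cancel hα).symm⟩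
  let _ : LinearOrder α := LinearOrder.lift' f hf
  have hle : ∀ a b : α, f a ≤ f b ↔ a ≤ b := fun a b => Iff.rfl
  have hlt : ∀ a b : α, f a < f b ↔ a < b := fun a b => Iff.rfl
  let e : Fin (n + 2) ≃o α := Fintype.orderIsoFinOfCardEq α hn
  refine ⟨(e.symm.toEquiv.trans (finRotate (n + 2))).trans e.toEquiv, fun a => ?_,
    fun z hz a => ?_⟩
  · obtain ⟨i, rfl⟩ := e.surjective a
    change ¬ e (finRotate (n + 2) (e.symm (e i))) = e i
    rw [OrderIso.symm_apply_apply, e.injective.eq_iff, finRotate_apply]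
    intro h
    exact one_ne_zero (add_eq_left.1 h)
  · obtain ⟨i, rfl⟩ := e.surjective a
    change _ = ∑ b, if f b < f (e (finRotate (n + 2) (e.symm (e i)))) then z b else 0
    simp only [hle, hlt, OrderIso.symm_apply_apply]
    rw [← e.toEquiv.sum_comp, ← e.toEquiv.sum_comp]
    simp only [RelIso.coe_fn_toEquiv, e.le_iff_le, e.lt_iff_lt]
    rcases eq_or_ne i (Fin.last (n + 1)) with rfl | hi
    · rw [finRotate_last, Finset.sum_eq_zero (s := Finset.univ)
        (f := fun j => if j < (0 : Fin (n + 2)) then z (e j) else 0) (by simp)]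
      rw [← hz, ← e.toEquiv.sum_comp]
      exact Finset.sum_congr rfl fun j _ => if_pos (Fin.le_last j)
    · refine Finset.sum_congr rfl fun j _ => if_congr ?_ rfl rfl
      have : i < Fin.last (n + 1) := lt_of_le_of_ne (Fin.le_last i) hi
      rw [Fin.le_def, Fin.lt_def, coe_finRotate_of_ne_last hi]
      omega

namespace SimpleGraph

variable {V : Type*} {G : SimpleGraph V}

open Classical in
/-- A face tracing of a graph for which every cycle modulo two is the boundary of a union of
faces: a permutation `next` of the darts that sends each dart to the next one on the face to its
left. The function `L` in `boundary` tells which faces are taken, a face being an orbit. -/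
structure FaceTracing [Fintype V] (G : SimpleGraph V) where
  next : Equiv.Perm G.Dart
  fst_next : ∀ d, (next d).fst = d.snd
  next_ne_symm : ∀ d, next d ≠ d.symm
  boundary : ∀ z : G.edgeSet → ZMod 2, (∀ v, (∑ e, if v ∈ e.1 then z e else 0) = 0) →
    ∃ L : G.Dart → ZMod 2, (∀ d, L (next d) = L d) ∧
      ∀ d, L d + L d.symm = z ⟨d.edge, d.edge_mem⟩

namespace FaceTracing

variable [Fintype V] (N : FaceTracing G)

/-- The faces of a face tracing are the orbits of `next`. -/
def Face : Type _ := Quotient (Equiv.Perm.SameCycle.setoid N.next)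

instance : Finite N.Face := by classical exact inferInstanceAs (Finite (Quotient _))

/-- The face to the left of a dart. -/
def face (d : G.Dart) : N.Face := Quotient.mk (Equiv.Perm.SameCycle.setoid N.next) d

theorem face_next (d : G.Dart) : N.face (N.next d) = N.face d :=
  Quotient.sound (s := Equiv.Perm.SameCycle.setoid N.next)
    (Equiv.Perm.sameCycle_apply_left.2 (Equiv.Perm.SameCycle.refl _ _))

theorem eq_of_face_eq {α : Type*} {L : G.Dart → α} (hL : ∀ d, L (N.next d) = L d) {d d' : G.Dart}
    (h : N.face d = N.face d') : L d = L d' := by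
  classical
  obtain ⟨i, -, rfl⟩ := (show N.next.SameCycle d d' from Quotient.exact h).exists_pow_eq'
  clear h
  induction i with
  | zero => rfl
  | succ i ih => rw [pow_succ', Equiv.Perm.mul_apply, hL, ih]

/-- The half of Euler's formula that bounds the number of edges: the cycle space has dimension at
least `E - V + 1`, and at most the number of faces less one, as the union of all faces has empty
boundary. -/
theorem card_edgeSet_add_two_le [Nonempty G.Dart] :
    Nat.card G.edgeSet + 2 ≤ Nat.card V + Nat.card N.Face := by
  classical
  let _ : Fintype N.Face := Fintype.ofFinite _
  have hd : ∀ e : G.edgeSet, ∃ d : G.Dart, d.edge = e.1 := by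
    rintro ⟨e, he⟩
    induction e with | _ u v
    exact ⟨⟨(u, v), he⟩, rfl⟩
  choose d hd using hd
  -- boundary of a set of faces, boundary of a set of edges, and parity of a set of vertices
  let Φ : (N.Face → ZMod 2) →ₗ[ZMod 2] (G.edgeSet → ZMod 2) :=
    { toFun := fun L e => L (N.face (d e)) + L (N.face (d e).symm)
      map_add' := fun L L' => by funext e; simp only [Pi.add_apply]; ring
      map_smul' := fun a L => by
        funext e; simp only [Pi.smul_apply, smul_eq_mul, RingHom.id_apply]; ring }
  let δ : (G.edgeSet → ZMod 2) →ₗ[ZMod 2] (V → ZMod 2) :=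
    LinearMap.pi fun v =>
      (∑ e, if v ∈ e.1 then LinearMap.proj e else 0 : (G.edgeSet → ZMod 2) →ₗ[ZMod 2] ZMod 2)
  let σ : (V → ZMod 2) →ₗ[ZMod 2] ZMod 2 := ∑ v, LinearMap.proj v
  have hδ : ∀ z v, δ z v = ∑ e, if v ∈ e.1 then z e else 0 := by
    intro z v
    simp only [δ, LinearMap.pi_apply, LinearMap.sum_apply]
    exact Finset.sum_congr rfl fun e _ => by split_ifs <;> rfl
  have hσ : ∀ w, σ w = ∑ v, w v := fun w => by simp [σ]
  have h1 : LinearMap.ker δ ≤ LinearMap.range Φ := by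
    intro z hz
    obtain ⟨L, hL, hL'⟩ := N.boundary z fun v => by
      rw [← hδ, LinearMap.mem_ker.1 hz]; rfl
    refine ⟨fun f => L f.out, ?_⟩
    have hout : ∀ a : G.Dart, L (N.face a).out = L a := fun a =>
      N.eq_of_face_eq hL (Quotient.out_eq _)
    funext e
    change L (N.face (d e)).out + L (N.face (d e).symm).out = z e
    rw [hout, hout, hL']
    congr 1
    exact Subtype.ext (hd e)
  have h2 : LinearMap.range δ ≤ LinearMap.ker σ := by
    rintro _ ⟨z, rfl⟩
    rw [LinearMap.mem_ker, hσ]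
    simp only [hδ]
    rw [Finset.sum_comm]
    refine Finset.sum_eq_zero fun e _ => ?_
    obtain ⟨e, he⟩ := e
    induction e with | _ u v
    have huv : u ≠ v := G.ne_of_adj he
    rw [← Finset.sum_filter, Finset.sum_const]
    have : (Finset.univ.filter fun w => w ∈ s(u, v)) = {u, v} := by ext; simp
    rw [this, Finset.card_pair huv, CharTwo.two_nsmul]
  have h3 : 1 ≤ Module.finrank (ZMod 2) (LinearMap.ker Φ) := by
    rw [Nat.one_le_iff_ne_zero, Ne, Submodule.finrank_eq_zero]
    intro h
    have : (fun _ => 1 : N.Face → ZMod 2) ∈ LinearMap.ker Φ := by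
      rw [LinearMap.mem_ker]
      funext e
      exact CharTwo.add_self_eq_zero (1 : ZMod 2)
    rw [h, Submodule.mem_bot] at this
    exact one_ne_zero (congrFun this (N.face (Classical.arbitrary G.Dart)))
  have h4 : 1 ≤ Module.finrank (ZMod 2) (LinearMap.range σ) := by
    rw [Nat.one_le_iff_ne_zero, Ne, Submodule.finrank_eq_zero]
    intro h
    have v := (Classical.arbitrary G.Dart).fst
    have : σ (Pi.single v 1) ∈ LinearMap.range σ := ⟨_, rfl⟩
    rw [h, Submodule.mem_bot, hσ] at this
    simp at this
  have r1 := LinearMap.finrank_range_add_finrank_ker Φ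
  have r2 := LinearMap.finrank_range_add_finrank_ker δ
  have r3 := LinearMap.finrank_range_add_finrank_ker σ
  have r4 := Submodule.finrank_mono h1
  have r5 := Submodule.finrank_mono h2
  rw [Module.finrank_fintype_fun_eq_card] at r1 r2 r3
  simp only [Nat.card_eq_fintype_card]
  omega

theorem next_ne (d : G.Dart) : N.next d ≠ d := fun h => by
  have := N.fst_next d
  rw [h] at this
  exact G.ne_of_adj d.adj this

theorem next_next_ne (d : G.Dart) : N.next (N.next d) ≠ d := fun h => by
  have h1 := N.fst_next d
  have h2 := N.fst_next (N.next d)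
  rw [h] at h2
  exact N.next_ne_symm d (Dart.ext _ _ (Prod.ext h1 h2.symm))

/-- If every face has at least `g` darts, then `g F ≤ 2 E`. -/
theorem mul_card_face_le {g : ℕ} (hg : ∀ d, ∃ s : Finset G.Dart, g ≤ s.card ∧
    ∀ d' ∈ s, N.face d' = N.face d) : g * Nat.card N.Face ≤ 2 * Nat.card G.edgeSet := by
  classical
  let _ : Fintype N.Face := Fintype.ofFinite _
  rw [Nat.card_eq_fintype_card, Nat.card_eq_fintype_card, ← edgeFinset_card,
    ← dart_card_eq_twice_card_edges, ← Finset.card_univ, ← Finset.card_univ,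
    Finset.card_eq_sum_card_fiberwise (f := N.face) (t := Finset.univ) (fun _ _ => by simp),
    mul_comm, ← smul_eq_mul]
  refine Finset.card_nsmul_le_sum _ _ _ fun f _ => ?_
  obtain ⟨d, rfl⟩ := Quotient.exists_rep f
  obtain ⟨s, hs, hs'⟩ := hg d
  exact hs.trans (Finset.card_le_card fun d' hd' => by
    simp only [Finset.mem_filter, Finset.mem_univ, true_and]; exact hs' d' hd')

/-- In a simple graph faces have length at least three, if `next` never turns back. -/
theorem three_mul_card_face_le : 3 * Nat.card N.Face ≤ 2 * Nat.card G.edgeSet := by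
  classical
  refine N.mul_card_face_le fun d => ⟨{d, N.next d, N.next (N.next d)}, ?_, ?_⟩
  · rw [Finset.card_eq_three.2 ⟨_, _, _, (N.next_ne d).symm, (N.next_next_ne d).symm,
      (N.next_ne _).symm, rfl⟩]
  · simp [N.face_next]

/-- In a bipartite graph faces have length at least four. -/
theorem four_mul_card_face_le {c : V → Bool} (hc : ∀ u v, G.Adj u v → c u ≠ c v) :
    4 * Nat.card N.Face ≤ 2 * Nat.card G.edgeSet := by
  classical
  have h3 : ∀ d, N.next (N.next (N.next d)) ≠ d := fun d h => by
    have h1 := hc _ _ d.adj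
    have h2 := hc _ _ (N.next d).adj
    have h3 := hc _ _ (N.next (N.next d)).adj
    have e3 := N.fst_next (N.next (N.next d))
    rw [h] at e3
    rw [N.fst_next] at h2
    rw [N.fst_next, ← e3] at h3
    cases ha : c d.fst <;> cases hb : c d.snd <;> simp_all
  refine N.mul_card_face_le fun d =>
    ⟨{d, N.next d, N.next (N.next d), N.next (N.next (N.next d))}, ?_, ?_⟩
  · rw [Finset.card_insert_of_notMem, Finset.card_eq_three.2 ⟨_, _, _, (N.next_ne _).symm,
      (N.next_next_ne _).symm, (N.next_ne _).symm, rfl⟩]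
    simp [(N.next_ne d).symm, (N.next_next_ne d).symm, (h3 d).symm]
  · simp [N.face_next]

end FaceTracing

end SimpleGraph

/-! ### Drawings with non-vertical segments -/

/-- A drawing whose edges are given as chains of non-vertical segments: the edge `e` runs from
`tail e` to `head e` through `node e 0, …, node e (len e)`. -/
structure PolylineDrawing {V : Type*} (G : SimpleGraph V) where
  point : V → Plane
  tail : G.edgeSet → V
  head : G.edgeSet → V
  mk_tail_head : ∀ e, s(tail e, head e) = e.1
  len : G.edgeSet → ℕ
  len_pos : ∀ e, 0 < len e
  node : G.edgeSet → ℕ → Plane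
  node_zero : ∀ e, node e 0 = point (tail e)
  node_len : ∀ e, node e (len e) = point (head e)
  fst_node_ne : ∀ e, ∀ i < len e, (node e i).1 ≠ (node e (i + 1)).1
  node_inj : ∀ e, ∀ i ≤ len e, ∀ j ≤ len e, node e i = node e j → i = j
  node_eq_node : ∀ e f, e ≠ f → ∀ i ≤ len e, ∀ j ≤ len f, node e i = node f j →
    i = 0 ∨ i = len e
  node_eq_point : ∀ e, ∀ i ≤ len e, ∀ v, node e i = point v →
    i = 0 ∧ v = tail e ∨ i = len e ∧ v = head e
  common_end : ∀ e f, ∀ i < len e, ∀ j < len f, (e = f → i ≠ j) →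
    ∀ q ∈ segment ℝ (node e i) (node e (i + 1)), q ∈ segment ℝ (node f j) (node f (j + 1)) →
    q = node e i ∨ q = node e (i + 1)

section Chain

variable {m : ℕ} {p : ℕ → Plane}

/-- The condition that a chain of segments does not touch itself. -/
def IsSimpleChain (m : ℕ) (p : ℕ → Plane) : Prop :=
  (∀ i < m, p i ≠ p (i + 1)) ∧
    (∀ i, i + 1 < m →
      segment ℝ (p i) (p (i + 1)) ∩ segment ℝ (p (i + 1)) (p (i + 2)) = {p (i + 1)}) ∧
    (∀ i j, i + 1 < j → j < m →
      Disjoint (segment ℝ (p i) (p (i + 1))) (segment ℝ (p j) (p (j + 1))))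

theorem IsSimpleChain.common_end (h : IsSimpleChain m p) {i j : ℕ} (hi : i < m) (hj : j < m)
    (hij : i ≠ j) {q : Plane} (hqi : q ∈ segment ℝ (p i) (p (i + 1)))
    (hqj : q ∈ segment ℝ (p j) (p (j + 1))) : q = p i ∨ q = p (i + 1) := by
  obtain ⟨-, h1, h2⟩ := h
  rcases lt_or_gt_of_ne hij with hlt | hlt
  · rcases eq_or_lt_of_le (Nat.succ_le_of_lt hlt) with rfl | hlt'
    · have : q ∈ ({p (i + 1)} : Set Plane) := h1 i hj ▸ ⟨hqi, hqj⟩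
      exact .inr this
    · exact absurd hqj (Set.disjoint_left.1 (h2 i j hlt' hj) hqi)
  · rcases eq_or_lt_of_le (Nat.succ_le_of_lt hlt) with rfl | hlt'
    · have : q ∈ ({p (j + 1)} : Set Plane) := h1 j hi ▸ ⟨hqj, hqi⟩
      exact .inl this
    · exact absurd hqi (Set.disjoint_left.1 (h2 j i hlt' hi) hqj)

theorem IsSimpleChain.ne_of_lt (h : IsSimpleChain m p) {i j : ℕ} (hj : j ≤ m) (hij : i < j) :
    p i ≠ p j := by
  intro he
  obtain ⟨k, rfl⟩ : ∃ k, j = k + 1 := ⟨j - 1, by omega⟩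
  rcases eq_or_lt_of_le (Nat.le_of_lt_succ hij) with rfl | hik
  · exact h.1 i hj he
  · have h1 : p i ∈ segment ℝ (p i) (p (i + 1)) := left_mem_segment _ _ _
    have h2 : p i ∈ segment ℝ (p k) (p (k + 1)) := he ▸ right_mem_segment _ _ _
    rcases eq_or_lt_of_le (Nat.succ_le_of_lt hik) with rfl | hlt'
    · have : p i ∈ ({p (i + 1)} : Set Plane) := h.2.1 i hj ▸ ⟨h1, h2⟩
      exact h.1 i (by omega) this
    · exact Set.disjoint_left.1 (h.2.2 i k hlt' hj) h1 h2

theorem IsSimpleChain.injOn (h : IsSimpleChain m p) {i j : ℕ} (hi : i ≤ m) (hj : j ≤ m)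
    (he : p i = p j) : i = j := by
  rcases lt_trichotomy i j with hlt | rfl | hlt
  · exact absurd he (h.ne_of_lt hj hlt)
  · rfl
  · exact absurd he.symm (h.ne_of_lt hi hlt)

theorem IsSimpleChain.eq_of_end_mem (h : IsSimpleChain m p) {i : ℕ} (hi : i < m) {q : Plane}
    (hq : q = p 0 ∨ q = p m) (hqi : q ∈ segment ℝ (p i) (p (i + 1))) :
    q = p i ∨ q = p (i + 1) := by
  rcases hq with hq | hq
  · by_cases h0 : i = 0
    · subst h0; exact .inl hq
    · exact h.common_end hi (by omega) h0 hqi (hq ▸ left_mem_segment _ _ _)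
  · by_cases h0 : i = m - 1
    · subst h0; right; rw [hq]; congr 1; omega
    · refine h.common_end hi (j := m - 1) (by omega) h0 hqi ?_
      rw [Nat.sub_add_cancel (by omega)]
      exact hq ▸ right_mem_segment _ _ _

end Chain

/-- A shear, used to make finitely many segments non-vertical. -/
def shear (t : ℝ) : Plane →ₗ[ℝ] Plane where
  toFun q := (q.1 + t * q.2, q.2)
  map_add' q r := by ext <;> simp; ring
  map_smul' a q := by ext <;> simp; ring

theorem shear_injective (t : ℝ) : Function.Injective (shear t) := by
  intro q r h
  have h2 : q.2 = r.2 := (Prod.ext_iff.1 h).2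
  have h1 : q.1 + t * q.2 = r.1 + t * r.2 := (Prod.ext_iff.1 h).1
  rw [h2] at h1
  exact Prod.ext (by linarith) h2

theorem exists_mem_segment_of_mem_shear {t : ℝ} {a b q : Plane}
    (h : q ∈ segment ℝ (shear t a) (shear t b)) : ∃ r ∈ segment ℝ a b, shear t r = q := by
  obtain ⟨x, y, hx, hy, hxy, rfl⟩ := h
  exact ⟨x • a + y • b, ⟨x, y, hx, hy, hxy, rfl⟩, by simp⟩

theorem exists_shear_fst_ne {ι : Type*} [Finite ι] (a b : ι → Plane) (h : ∀ i, a i ≠ b i) :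
    ∃ t, ∀ i, (shear t (a i)).1 ≠ (shear t (b i)).1 := by
  have hfin : (⋃ i, {t | (shear t (a i)).1 = (shear t (b i)).1}).Finite := by
    refine Set.finite_iUnion fun i => Set.Subsingleton.finite fun t ht u hu => ?_
    have ht : (a i).1 + t * (a i).2 = (b i).1 + t * (b i).2 := ht
    have hu : (a i).1 + u * (a i).2 = (b i).1 + u * (b i).2 := hu
    have h2 : (a i).2 - (b i).2 ≠ 0 := fun h2 => h i (by
      have h2' : (a i).2 = (b i).2 := by linarith
      rw [h2'] at ht
      exact Prod.ext (by linarith) h2')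
    refine mul_right_cancel₀ h2 ?_
    linarith
  obtain ⟨t, ht⟩ := hfin.exists_notMem
  exact ⟨t, fun i hi => ht (Set.mem_iUnion.2 ⟨i, hi⟩)⟩

/-- A plane drawing becomes one with non-vertical segments after a shear. -/
theorem PlaneDrawing.nonempty_polylineDrawing {V : Type*} [Finite V] {G : SimpleGraph V}
    (D : PlaneDrawing G) : Nonempty (PolylineDrawing G) := by
  classical
  have hends : ∀ e : G.edgeSet, ∃ x : V × V, s(x.1, x.2) = e.1 := by
    rintro ⟨e, he⟩
    induction e with | _ u v
    exact ⟨(u, v), rfl⟩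
  choose x hx using hends
  have harc : ∀ e : G.edgeSet, ∃ (m : ℕ) (p : ℕ → Plane), 0 < m ∧ p 0 = D.point (x e).1 ∧
      p m = D.point (x e).2 ∧ IsSimpleChain m p ∧
      D.arc e = ⋃ i ∈ Set.Iio m, segment ℝ (p i) (p (i + 1)) := by
    intro e
    have he : G.Adj (x e).1 (x e).2 := by
      rw [← SimpleGraph.mem_edgeSet, hx]; exact e.2
    obtain ⟨m, p, h1, h2, h3, h4, h5, h6, h7⟩ := D.isPolygonalArc _ _ he
    refine ⟨m, p, h1, h2, h3, ⟨h4, h5, h6⟩, ?_⟩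
    rw [← h7]
    congr 1
    exact Subtype.ext (hx e).symm
  choose m p hm h0 h1 hp harc using harc
  have hmem : ∀ e, ∀ i < m e, ∀ q ∈ segment ℝ (p e i) (p e (i + 1)), q ∈ D.arc e := by
    intro e i hi q hq
    rw [harc]
    exact Set.mem_biUnion (show i ∈ Set.Iio (m e) from hi) hq
  have hmem' : ∀ e, ∀ i ≤ m e, p e i ∈ D.arc e := by
    intro e i hi
    rcases eq_or_lt_of_le hi with rfl | hi
    · refine hmem e (m e - 1) (by have := hm e; omega) _ ?_
      rw [Nat.sub_add_cancel (hm e)]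
      exact right_mem_segment _ _ _
    · exact hmem e i hi _ (left_mem_segment _ _ _)
  have hpt : ∀ e, ∀ v ∈ e.1, D.point v = p e 0 ∧ v = (x e).1 ∨
      D.point v = p e (m e) ∧ v = (x e).2 := by
    intro e v hv
    rw [← hx, Sym2.mem_iff] at hv
    rcases hv with rfl | rfl
    · exact .inl ⟨(h0 e).symm, rfl⟩
    · exact .inr ⟨(h1 e).symm, rfl⟩
  have hpt' : ∀ e, ∀ v ∈ e.1, ∀ i ≤ m e, p e i = D.point v →
      i = 0 ∧ v = (x e).1 ∨ i = m e ∧ v = (x e).2 := by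
    intro e v hv i hi hi'
    rcases hpt e v hv with ⟨h, h'⟩ | ⟨h, h'⟩
    · exact .inl ⟨(hp e).injOn hi (Nat.zero_le _) (hi'.trans h), h'⟩
    · exact .inr ⟨(hp e).injOn hi le_rfl (hi'.trans h), h'⟩
  obtain ⟨t, ht⟩ := exists_shear_fst_ne (ι := Σ e, Fin (m e)) (fun j => p j.1 j.2)
    (fun j => p j.1 (j.2 + 1)) (fun j => (hp j.1).1 _ j.2.2)
  exact ⟨{
    point := fun v => shear t (D.point v)
    tail := fun e => (x e).1
    head := fun e => (x e).2
    mk_tail_head := hx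
    len := m
    len_pos := hm
    node := fun e i => shear t (p e i)
    node_zero := fun e => by rw [h0]
    node_len := fun e => by rw [h1]
    fst_node_ne := fun e i hi => ht ⟨e, i, hi⟩
    node_inj := fun e i hi j hj h => (hp e).injOn hi hj (shear_injective t h)
    node_eq_node := fun e f hef i hi j hj h => by
      have h := shear_injective t h
      obtain ⟨v, hv, -, hv'⟩ := D.common_end_of_mem_arcs e f hef (p e i)
        ⟨hmem' e i hi, h ▸ hmem' f j hj⟩
      exact (hpt' e v hv i hi hv').imp And.left And.left
    node_eq_point := fun e i hi v h => by
      have h := shear_injective t h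
      exact hpt' e v (D.mem_of_point_mem_arc e v (h ▸ hmem' e i hi)) i hi h
    common_end := fun e f i hi j hj hij q hq hq' => by
      obtain ⟨r, hr, rfl⟩ := exists_mem_segment_of_mem_shear hq
      obtain ⟨r', hr', he⟩ := exists_mem_segment_of_mem_shear hq'
      obtain rfl := shear_injective t he
      rw [(shear_injective t).eq_iff, (shear_injective t).eq_iff]
      by_cases hef : e = f
      · subst hef
        exact (hp e).common_end hi hj (hij rfl) hr hr'
      · obtain ⟨v, hv, -, rfl⟩ := D.common_end_of_mem_arcs e f hef r'
          ⟨hmem e i hi _ hr, hmem f j hj _ hr'⟩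
        exact (hp e).eq_of_end_mem hi ((hpt e v hv).imp And.left And.left) hr }⟩

namespace PolylineDrawing

variable {V : Type*} {G : SimpleGraph V} (P : PolylineDrawing G)

/-- The segments of all edges; a pair `⟨e, i⟩` stands for the `i`-th segment of the edge `e`. -/
abbrev Piece : Type _ := Σ e : G.edgeSet, Fin (P.len e)

open Classical in
/-- Whether a segment is traversed leftwards when going from the tail to the head of its edge. -/
noncomputable def leftward (j : P.Piece) : Bool :=
  decide ((P.node j.1 (j.2 + 1)).1 < (P.node j.1 j.2).1)

/-- The segments of all edges as a system of segments, each oriented from left to right. -/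
noncomputable def system : SegmentSystem P.Piece where
  left j := if P.leftward j then P.node j.1 (j.2 + 1) else P.node j.1 j.2
  right j := if P.leftward j then P.node j.1 j.2 else P.node j.1 (j.2 + 1)
  left_lt_right j := by
    have := P.fst_node_ne j.1 j.2 j.2.2
    simp only [leftward, decide_eq_true_eq]
    split_ifs with h
    · exact h
    · exact lt_of_le_of_ne (not_lt.1 h) this
  common_end j k hjk q hq := by
    have hjk' : j.1 = k.1 → (j.2 : ℕ) ≠ k.2 := by
      rintro h h'
      obtain ⟨e, i⟩ := j
      obtain ⟨f, i'⟩ := k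
      dsimp only at h
      subst h
      exact hjk (congrArg (Sigma.mk e) (Fin.ext h'))
    have hs : ∀ l : P.Piece, segment ℝ (if P.leftward l then P.node l.1 (l.2 + 1) else
        P.node l.1 l.2) (if P.leftward l then P.node l.1 l.2 else P.node l.1 (l.2 + 1)) =
        segment ℝ (P.node l.1 l.2) (P.node l.1 (l.2 + 1)) := by
      intro l
      split_ifs
      · exact segment_symm _ _ _
      · rfl
    rw [hs, hs] at hq
    have h1 := P.common_end _ _ _ j.2.2 _ k.2.2 hjk' q hq.1 hq.2
    have h2 := P.common_end _ _ _ k.2.2 _ j.2.2 (fun h h' => hjk' h.symm h'.symm) q hq.2 hq.1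
    constructor
    · split_ifs <;> tauto
    · split_ifs <;> tauto

/-- A segment oriented from the tail to the head of its edge. -/
noncomputable def forward (j : P.Piece) : P.Piece × Bool := (j, P.leftward j)

/-- A segment oriented from the head to the tail of its edge. -/
noncomputable def backward (j : P.Piece) : P.Piece × Bool := (j, !P.leftward j)

theorem source_forward (j : P.Piece) : P.system.source (P.forward j) = P.node j.1 j.2 := by
  by_cases h : P.leftward j = true <;> simp [SegmentSystem.source, forward, system, h]

theorem source_backward (j : P.Piece) :
    P.system.source (P.backward j) = P.node j.1 (j.2 + 1) := by
  by_cases h : P.leftward j = true <;> simp [SegmentSystem.source, backward, system, h]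

theorem eq_forward_or_eq_backward (δ : P.Piece × Bool) :
    δ = P.forward δ.1 ∨ δ = P.backward δ.1 := by
  obtain ⟨j, o⟩ := δ
  simp only [forward, backward, Prod.mk.injEq, true_and]
  cases o <;> cases P.leftward j <;> simp

theorem last_lt (e : G.edgeSet) : P.len e - 1 < P.len e := Nat.sub_lt (P.len_pos e) one_pos

open Classical in
/-- The oriented segment by which a dart leaves its vertex. -/
noncomputable def first (d : G.Dart) : P.Piece × Bool :=
  if d.fst = P.tail ⟨d.edge, d.edge_mem⟩ then P.forward ⟨⟨d.edge, d.edge_mem⟩, 0, P.len_pos _⟩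
  else P.backward ⟨⟨d.edge, d.edge_mem⟩, P.len ⟨d.edge, d.edge_mem⟩ - 1, P.last_lt _⟩

theorem first_fst (d : G.Dart) : (P.first d).1.1 = ⟨d.edge, d.edge_mem⟩ := by
  unfold first; split_ifs <;> rfl

theorem fst_eq_tail_or (d : G.Dart) :
    d.fst = P.tail ⟨d.edge, d.edge_mem⟩ ∧ d.snd = P.head ⟨d.edge, d.edge_mem⟩ ∨
      d.fst = P.head ⟨d.edge, d.edge_mem⟩ ∧ d.snd = P.tail ⟨d.edge, d.edge_mem⟩ := by
  have : s(P.tail ⟨d.edge, d.edge_mem⟩, P.head ⟨d.edge, d.edge_mem⟩) = s(d.fst, d.snd) :=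
    P.mk_tail_head ⟨d.edge, d.edge_mem⟩
  rw [Sym2.eq_iff] at this
  rcases this with ⟨h, h'⟩ | ⟨h, h'⟩
  · exact .inl ⟨h.symm, h'.symm⟩
  · exact .inr ⟨h'.symm, h.symm⟩

theorem source_first (d : G.Dart) : P.system.source (P.first d) = P.point d.fst := by
  unfold first
  split_ifs with h
  · rw [P.source_forward, h]; exact P.node_zero _
  · rw [P.source_backward, ((P.fst_eq_tail_or d).resolve_left fun h' => h h'.1).1, ← P.node_len]
    simp only [Nat.sub_add_cancel (P.len_pos _)]

theorem eq_of_first_eq {d d' : G.Dart} (h : P.first d = P.first d') (h' : d.fst = d'.fst) :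
    d = d' := by
  have h1 := P.first_fst d
  rw [h, P.first_fst, Subtype.mk.injEq] at h1
  rcases (SimpleGraph.dart_edge_eq_iff _ _).1 h1 with h2 | h2
  · exact h2.symm
  · rw [h2] at h'
    exact absurd h' (G.ne_of_adj d.adj)

/-- The oriented segments that leave the point of a vertex are those by which a dart leaves it. -/
theorem exists_first_eq {v : V} {δ : P.Piece × Bool} (h : P.system.source δ = P.point v) :
    ∃ d : G.Dart, d.fst = v ∧ P.first d = δ := by
  obtain ⟨⟨e, i, hi⟩, o⟩ := δ
  have hadj : G.Adj (P.tail e) (P.head e) := by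
    have := e.2
    rwa [← P.mk_tail_head e] at this
  have hpos := P.len_pos e
  classical
  rcases P.eq_forward_or_eq_backward (⟨e, i, hi⟩, o) with h' | h'
  · rw [h', P.source_forward] at h
    obtain ⟨rfl, rfl⟩ : i = 0 ∧ v = P.tail e := by
      rcases P.node_eq_point e i hi.le v h with h | h
      · exact h
      · omega
    refine ⟨⟨(P.tail e, P.head e), hadj⟩, rfl, ?_⟩
    have he : (⟨s(P.tail e, P.head e), hadj⟩ : G.edgeSet) = e := Subtype.ext (P.mk_tail_head e)
    rw [h']
    unfold first
    change (if P.tail e = P.tail ⟨s(P.tail e, P.head e), hadj⟩ then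
      P.forward ⟨⟨s(P.tail e, P.head e), hadj⟩, 0, P.len_pos _⟩ else
      P.backward ⟨⟨s(P.tail e, P.head e), hadj⟩, _, P.last_lt _⟩) = _
    rw [if_pos (by rw [he])]
    have : ∀ f (hf : f = e), P.forward ⟨f, 0, P.len_pos f⟩ = P.forward ⟨e, 0, hi⟩ := by
      rintro f rfl
      rfl
    exact this _ he
  · rw [h', P.source_backward] at h
    obtain ⟨hi', rfl⟩ : i + 1 = P.len e ∧ v = P.head e := by
      rcases P.node_eq_point e (i + 1) hi v h with h | h
      · omega
      · exact h
    refine ⟨⟨(P.head e, P.tail e), hadj.symm⟩, rfl, ?_⟩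
    have he : (⟨s(P.head e, P.tail e), hadj.symm⟩ : G.edgeSet) = e :=
      Subtype.ext (Sym2.eq_swap.trans (P.mk_tail_head e))
    rw [h']
    unfold first
    change (if P.head e = P.tail ⟨s(P.head e, P.tail e), hadj.symm⟩ then
      P.forward ⟨⟨s(P.head e, P.tail e), hadj.symm⟩, 0, P.len_pos _⟩ else
      P.backward ⟨⟨s(P.head e, P.tail e), hadj.symm⟩, _, P.last_lt _⟩) = _
    rw [if_neg (by rw [he]; exact (G.ne_of_adj hadj).symm)]
    have : ∀ f (hf : f = e), P.backward ⟨f, P.len f - 1, P.last_lt f⟩ =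
        P.backward ⟨e, i, hi⟩ := by
      rintro f rfl
      congr! 3
      omega
    exact this _ he

variable [Fintype G.edgeSet] (z : G.edgeSet → ZMod 2)

open Classical in
/-- A cycle of the graph gives an even weight on the segments: at interior nodes of an edge two
segments with the same weight meet. -/
theorem isEven (hz : ∀ v, (∑ e, if v ∈ e.1 then z e else 0) = 0) :
    P.system.IsEven fun j : P.Piece => z j.1 := by
  intro q
  rw [Fintype.sum_sigma]
  have h1 : ∀ e, (∑ i : Fin (P.len e), ((if P.system.left ⟨e, i⟩ = q then z e else 0) +
      if P.system.right ⟨e, i⟩ = q then z e else 0)) =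
      (if P.point (P.tail e) = q then z e else 0) + if P.point (P.head e) = q then z e else 0 := by
    intro e
    have h2 : ∀ i : Fin (P.len e), ((if P.system.left ⟨e, i⟩ = q then z e else 0) +
        if P.system.right ⟨e, i⟩ = q then z e else 0) =
        (if P.node e (i + 1) = q then z e else 0) - if P.node e i = q then z e else 0 := by
      intro i
      rw [CharTwo.sub_eq_add]
      simp only [system]
      cases P.leftward ⟨e, i⟩
      · simp only [Bool.false_eq_true, if_false]
        rw [add_comm]
      · simp only [if_true]
    simp only [h2]
    rw [Fin.sum_univ_eq_sum_range (fun i => (if P.node e (i + 1) = q then z e else 0) -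
      if P.node e i = q then z e else 0),
      Finset.sum_range_sub (fun i => if P.node e i = q then z e else 0), P.node_zero, P.node_len,
      CharTwo.sub_eq_add, add_comm]
  simp only [h1]
  by_cases hq : ∃ v, P.point v = q
  · obtain ⟨v, rfl⟩ := hq
    refine Eq.trans (Finset.sum_congr rfl fun e _ => ?_) (hz v)
    have hinj : ∀ w, P.point (P.tail e) = P.point w ↔ P.tail e = w := by
      refine fun w => ⟨fun h => ?_, fun h => by rw [h]⟩
      have := P.node_eq_point e 0 (Nat.zero_le _) w (by rw [P.node_zero, h])
      have := P.len_pos e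
      rcases ‹_ ∨ _› with h | h
      · exact h.2.symm
      · omega
    have hinj' : ∀ w, P.point (P.head e) = P.point w ↔ P.head e = w := by
      refine fun w => ⟨fun h => ?_, fun h => by rw [h]⟩
      have := P.node_eq_point e _ le_rfl w (by rw [P.node_len, h])
      have := P.len_pos e
      rcases ‹_ ∨ _› with h | h
      · omega
      · exact h.2.symm
    have hne : P.tail e ≠ P.head e := by
      have := e.2
      rw [← P.mk_tail_head e] at this
      exact G.ne_of_adj this
    rw [if_congr (hinj v) rfl rfl, if_congr (hinj' v) rfl rfl, ← P.mk_tail_head e]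
    simp only [Sym2.mem_iff]
    by_cases ht : P.tail e = v
    · have hh : P.head e ≠ v := fun h => hne (ht.trans h.symm)
      simp [ht, hh]
    · simp [ht, Ne.symm ht, eq_comm]
  · push Not at hq
    exact Finset.sum_eq_zero fun e _ => by rw [if_neg (hq _), if_neg (hq _), add_zero]

variable {z}

/-- The left colour does not change at an interior node of an edge, where only two segments meet. -/
theorem leftParity_forward_succ (hz : P.system.IsEven fun j : P.Piece => z j.1) (e : G.edgeSet)
    (i : ℕ) (hi : i + 1 < P.len e) :
    P.system.leftParity (fun j : P.Piece => z j.1) (P.forward ⟨e, i + 1, hi⟩) =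
      P.system.leftParity (fun j : P.Piece => z j.1) (P.forward ⟨e, i, by omega⟩) := by
  classical
  have h1 : P.system.source (P.forward ⟨e, i + 1, hi⟩) = P.node e (i + 1) := P.source_forward _
  have h2 : P.system.source (P.backward ⟨e, i, by omega⟩) = P.node e (i + 1) := P.source_backward _
  have hne : P.forward ⟨e, i + 1, hi⟩ ≠ P.backward ⟨e, i, by omega⟩ := by
    intro h
    have h := congrArg Prod.fst h
    simp only [forward, backward, Sigma.mk.injEq, heq_eq_eq, true_and, Fin.mk.injEq] at h
    omega
  have hset : (Finset.univ.filter fun ζ => P.system.source ζ = P.node e (i + 1)) =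
      {P.forward ⟨e, i + 1, hi⟩, P.backward ⟨e, i, by omega⟩} := by
    ext ζ
    simp only [Finset.mem_filter, Finset.mem_univ, true_and, Finset.mem_insert,
      Finset.mem_singleton]
    constructor
    · intro hζ
      have key : ∀ f, ∀ k ≤ P.len f, P.node f k = P.node e (i + 1) → f = e ∧ k = i + 1 := by
        intro f k hk h
        by_cases hfe : f = e
        · subst hfe
          exact ⟨rfl, P.node_inj f k hk _ hi.le h⟩
        · have := P.node_eq_node e f (Ne.symm hfe) (i + 1) hi.le k hk h.symm
          omega
      obtain ⟨⟨f, k, hk⟩, o⟩ := ζ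
      rcases P.eq_forward_or_eq_backward (⟨f, k, hk⟩, o) with h | h
      · left
        rw [h, P.source_forward] at hζ
        obtain ⟨rfl, rfl⟩ := key f k hk.le hζ
        exact h
      · right
        rw [h, P.source_backward] at hζ
        obtain ⟨rfl, h'⟩ := key f (k + 1) hk hζ
        obtain rfl : k = i := by omega
        exact h
    · rintro (rfl | rfl)
      exacts [h1, h2]
  refine (hz.leftParity_eq_of_sum_eq _ (ε := P.backward ⟨e, i, by omega⟩)
    (h1.trans h2.symm) ?_).trans ?_
  · simp only [ite_and, h1, h2]
    have hsum : ∀ w : P.Piece × Bool → ZMod 2,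
        (∑ ζ, if P.system.source ζ = P.node e (i + 1) then w ζ else 0) =
        w (P.forward ⟨e, i + 1, hi⟩) + w (P.backward ⟨e, i, by omega⟩) := by
      intro w
      rw [← Finset.sum_filter, hset, Finset.sum_pair hne]
    rw [hsum, hsum]
    have hk : P.system.angleKey (P.forward ⟨e, i + 1, hi⟩) ≠
        P.system.angleKey (P.backward ⟨e, i, by omega⟩) := fun h =>
      hne (P.system.eq_of_source_eq_of_angleKey_eq (h1.trans h2.symm) h)
    rcases lt_or_gt_of_ne hk with h | h
    · simp only [h, le_refl, lt_irrefl, if_true, if_false, h.not_ge]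
    · simp only [h.le, le_refl, lt_irrefl, if_true, if_false, h.not_gt]
      exact CharTwo.add_self_eq_zero (z e)
  · simp only [backward, forward, Bool.not_not]

theorem leftParity_forward_eq (hz : P.system.IsEven fun j : P.Piece => z j.1) (e : G.edgeSet)
    (i : ℕ) (hi : i < P.len e) :
    P.system.leftParity (fun j : P.Piece => z j.1) (P.forward ⟨e, i, hi⟩) =
      P.system.leftParity (fun j : P.Piece => z j.1) (P.forward ⟨e, 0, P.len_pos e⟩) := by
  induction i with
  | zero => rfl
  | succ i ih => rw [P.leftParity_forward_succ hz, ih]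

/-- The colours on the two sides of an edge differ by its weight. -/
theorem leftParity_first_add (hz : P.system.IsEven fun j : P.Piece => z j.1) (d : G.Dart) :
    P.system.leftParity (fun j : P.Piece => z j.1) (P.first d) +
      P.system.leftParity (fun j : P.Piece => z j.1) (P.first d.symm) =
      z ⟨d.edge, d.edge_mem⟩ := by
  classical
  -- it suffices to treat the dart that leaves the tail of its edge
  have key : ∀ d : G.Dart, d.fst = P.tail ⟨d.edge, d.edge_mem⟩ →
      P.system.leftParity (fun j : P.Piece => z j.1) (P.first d) +
        P.system.leftParity (fun j : P.Piece => z j.1) (P.first d.symm) =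
        z ⟨d.edge, d.edge_mem⟩ := by
    intro d hd
    have he : (⟨d.symm.edge, d.symm.edge_mem⟩ : G.edgeSet) = ⟨d.edge, d.edge_mem⟩ :=
      Subtype.ext d.edge_symm
    have h1 : P.first d = P.forward ⟨⟨d.edge, d.edge_mem⟩, 0, P.len_pos _⟩ := if_pos hd
    have h2 : P.first d.symm = P.backward ⟨⟨d.edge, d.edge_mem⟩, _, P.last_lt _⟩ := by
      unfold first
      rw [if_neg]
      · have : ∀ f (hf : f = ⟨d.edge, d.edge_mem⟩), P.backward ⟨f, P.len f - 1, P.last_lt f⟩ =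
            P.backward ⟨⟨d.edge, d.edge_mem⟩, _, P.last_lt _⟩ := by
          rintro _ rfl
          rfl
        exact this _ he
      · rw [he, ← hd]
        exact (G.ne_of_adj d.adj).symm
    rw [h1, h2, ← P.leftParity_forward_eq hz _ _ (P.last_lt _)]
    exact P.system.leftParity_add_leftParity_not (fun j : P.Piece => z j.1) _ _
  rcases P.fst_eq_tail_or d with h | h
  · exact key d h.1
  · have he : (⟨d.symm.edge, d.symm.edge_mem⟩ : G.edgeSet) = ⟨d.edge, d.edge_mem⟩ :=
      Subtype.ext d.edge_symm
    have := key d.symm (by rw [he]; exact h.2)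
    rwa [he, d.symm_symm, add_comm] at this

end PolylineDrawing

/-! ### The face tracing of a plane drawing -/

namespace PolylineDrawing

variable {V : Type*} {G : SimpleGraph V} (P : PolylineDrawing G)

open Classical in
theorem sum_source_eq [Fintype V] (v : V) (w : P.Piece × Bool → ZMod 2) :
    (∑ ζ, if P.system.source ζ = P.point v then w ζ else 0) =
      ∑ d : {d : G.Dart // d.fst = v}, w (P.first d) := by
  rw [← Finset.sum_filter]
  symm
  refine Finset.sum_bij (fun d _ => P.first d) ?_ ?_ ?_ (fun _ _ => rfl)
  · rintro ⟨d, rfl⟩ -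
    simpa using P.source_first d
  · rintro ⟨d, hd⟩ - ⟨d', hd'⟩ - h
    exact Subtype.ext (P.eq_of_first_eq h (hd.trans hd'.symm))
  · intro ζ hζ
    obtain ⟨d, hd, hd'⟩ := P.exists_first_eq (by simpa using hζ)
    exact ⟨⟨d, hd⟩, Finset.mem_univ _, hd'⟩

open Classical in
theorem sum_incident_eq [Fintype V] (v : V) (z : G.edgeSet → ZMod 2) :
    (∑ e, if v ∈ e.1 then z e else 0) =
      ∑ d : {d : G.Dart // d.fst = v}, z ⟨d.1.edge, d.1.edge_mem⟩ := by
  rw [← Finset.sum_filter]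
  symm
  refine Finset.sum_bij (fun d _ => ⟨d.1.edge, d.1.edge_mem⟩) ?_ ?_ ?_ (fun _ _ => rfl)
  · rintro ⟨d, rfl⟩ -
    simp [SimpleGraph.Dart.edge, Sym2.mem_iff]
  · rintro ⟨d, rfl⟩ - ⟨d', hd'⟩ - h
    rcases (SimpleGraph.dart_edge_eq_iff _ _).1 (Subtype.mk.inj h) with h2 | h2
    · exact Subtype.ext h2
    · dsimp only at h2
      rw [h2] at hd'
      exact absurd hd' (G.ne_of_adj d'.adj)
  · rintro ⟨e, he⟩ hv
    induction e with | _ a b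
    have hv : v = a ∨ v = b := by simpa using hv
    rcases hv with rfl | rfl
    · exact ⟨⟨⟨(v, b), he⟩, rfl⟩, Finset.mem_univ _, rfl⟩
    · exact ⟨⟨⟨(v, a), (show G.Adj a v from he).symm⟩, rfl⟩, Finset.mem_univ _,
        Subtype.ext Sym2.eq_swap⟩

open Classical in
/-- The darts at each vertex are ordered cyclically by direction; the next dart on a face is the
clockwise neighbour of the reversed dart. -/
theorem nonempty_faceTracing [Fintype V] (P : PolylineDrawing G)
    (hdeg : ∀ v, 2 ≤ Fintype.card {d : G.Dart // d.fst = v}) : Nonempty G.FaceTracing := by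
  have hinj : ∀ v, Function.Injective fun d : {d : G.Dart // d.fst = v} =>
      P.system.angleKey (P.first d) := by
    rintro v ⟨d, hd⟩ ⟨d', hd'⟩ h
    refine Subtype.ext (P.eq_of_first_eq (P.system.eq_of_source_eq_of_angleKey_eq ?_ h)
      (hd.trans hd'.symm))
    rw [P.source_first, P.source_first, hd, hd']
  choose σ hσ hσ' using fun v => exists_cyclic_successor (hinj v) (hdeg v)
  let ρ : Equiv.Perm G.Dart :=
    ((Equiv.sigmaFiberEquiv fun d : G.Dart => d.fst).symm.trans (Equiv.sigmaCongrRight σ)).trans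
      (Equiv.sigmaFiberEquiv fun d : G.Dart => d.fst)
  have hρ : ∀ d, ρ d = (σ d.fst ⟨d, rfl⟩).1 := fun d => rfl
  have hρ1 : ∀ d, (ρ d).fst = d.fst := fun d => by rw [hρ]; exact (σ d.fst ⟨d, rfl⟩).2
  have hρ2 : ∀ d, ρ d ≠ d := fun d h => hσ d.fst ⟨d, rfl⟩ (Subtype.ext ((hρ d).symm.trans h))
  have hρ3 : ∀ d, (ρ.symm d).fst = d.fst := fun d => by
    rw [← hρ1 (ρ.symm d), Equiv.apply_symm_apply]
  -- `ρ` turns anticlockwise to the next dart at the same vertex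
  let τ : Equiv.Perm G.Dart := ⟨SimpleGraph.Dart.symm, SimpleGraph.Dart.symm,
    SimpleGraph.Dart.symm_symm, SimpleGraph.Dart.symm_symm⟩
  refine ⟨⟨τ.trans ρ.symm, fun d => hρ3 d.symm, fun d h => hρ2 d.symm ?_, fun z hz => ?_⟩⟩
  · have h' : ρ.symm d.symm = d.symm := h
    exact (Equiv.symm_apply_eq _).1 h' |>.symm
  · have he := P.isEven z (by convert hz)
    refine ⟨fun d => P.system.leftParity (fun j : P.Piece => z j.1) (P.first d), fun d => ?_,
      fun d => P.leftParity_first_add he d⟩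
    obtain ⟨δ, hδ⟩ : ∃ δ, ρ δ = d.symm := ⟨ρ.symm d.symm, ρ.apply_symm_apply _⟩
    have h1 : τ.trans ρ.symm d = δ := by
      change ρ.symm d.symm = δ
      rw [← hδ, Equiv.symm_apply_apply]
    rw [h1]
    have hs : P.system.source (P.first δ) = P.system.source (P.first d.symm) := by
      rw [P.source_first, P.source_first, ← hδ, hρ1]
    have hsum := hσ' δ.fst (fun d' => z ⟨d'.1.edge, d'.1.edge_mem⟩)
      (by rw [← sum_incident_eq]; convert hz δ.fst) ⟨δ, rfl⟩
    have h2 := he.leftParity_eq_of_sum_eq P.system hs (by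
      simp only [ite_and]
      rw [← hs, P.source_first, P.sum_source_eq, P.sum_source_eq]
      simp only [P.first_fst]
      refine Eq.trans ?_ (hsum.trans ?_)
      · exact Finset.sum_congr rfl fun d' _ => if_congr Iff.rfl rfl rfl
      · rw [← hρ, hδ])
    refine h2.trans ?_
    have h3 := P.system.leftParity_add_leftParity_not (fun j : P.Piece => z j.1)
      (P.first d.symm).1 (P.first d.symm).2
    have h4 := P.leftParity_first_add he d.symm
    rw [P.first_fst] at h3
    rw [SimpleGraph.Dart.symm_symm] at h4
    exact add_left_cancel (h3.trans h4.symm)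

end PolylineDrawing

theorem PlaneDrawing.nonempty_faceTracing {V : Type*} [Fintype V] {G : SimpleGraph V}
    (D : PlaneDrawing G) (hdeg : ∀ v, 2 ≤ Nat.card {d : G.Dart // d.fst = v}) :
    Nonempty G.FaceTracing := by
  classical
  obtain ⟨P⟩ := D.nonempty_polylineDrawing
  exact P.nonempty_faceTracing fun v => by simpa only [Nat.card_eq_fintype_card] using hdeg v

/-! ### The number of edges of a plane graph -/

namespace PlaneDrawing

variable {V W : Type*} {G : SimpleGraph V} {H : SimpleGraph W}

/-- A drawing of a graph restricts to a drawing of each copy of a graph in it. -/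
def ofCopy (D : PlaneDrawing G) (f : H.Copy G) : PlaneDrawing H where
  point v := D.point (f v)
  arc e := D.arc (f.mapEdgeSet e)
  point_injective := D.point_injective.comp f.injective
  isPolygonalArc u v h := D.isPolygonalArc (f u) (f v) (f.toHom.map_adj h)
  mem_of_point_mem_arc e x hx := by
    obtain ⟨y, hy, hyx⟩ := Sym2.mem_map.1 (D.mem_of_point_mem_arc (f.mapEdgeSet e) (f x) hx)
    exact f.injective hyx ▸ hy
  common_end_of_mem_arcs e e' hee' q hq := by
    obtain ⟨x, hx, hx', rfl⟩ := D.common_end_of_mem_arcs _ _ (f.mapEdgeSet.injective.ne hee') q hq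
    obtain ⟨y, hy, rfl⟩ := Sym2.mem_map.1 hx
    obtain ⟨y', hy', hyy'⟩ := Sym2.mem_map.1 hx'
    exact ⟨y, hy, f.injective hyy' ▸ hy', rfl⟩

/-- The bounds `3V - 6` and, for bipartite graphs, `2V - 4` on the number of edges of a plane graph,
as one statement with `r = 3` and `r = 2` respectively. Vertices of degree at most one, at which a
face tracing would turn back, are deleted by induction. -/
theorem card_edgeSet_add_le [Finite V] (D : PlaneDrawing G) {r : ℕ}
    (hr : r = 3 ∨ r = 2 ∧ ∃ c : V → Bool, ∀ u v, G.Adj u v → c u ≠ c v) (hV : 3 ≤ Nat.card V) :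
    Nat.card G.edgeSet + 2 * r ≤ r * Nat.card V := by
  classical
  obtain ⟨n, hn⟩ : ∃ n, n = Nat.card V := ⟨_, rfl⟩
  induction n generalizing V with
  | zero => omega
  | succ n ih =>
    let _ : Fintype V := Fintype.ofFinite V
    have hdart : ∀ v, Nat.card {d : G.Dart // d.fst = v} = G.degree v := fun v => by
      rw [Nat.card_eq_fintype_card, Fintype.card_subtype]
      exact G.dart_fst_fiber_card_eq_degree v
    by_cases hdeg : ∀ v, 2 ≤ G.degree v
    · obtain ⟨N⟩ := D.nonempty_faceTracing fun v => (hdart v).symm ▸ hdeg v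
      have v : V := (Finite.card_pos_iff.1 (by omega : 0 < Nat.card V)).some
      have : Nonempty G.Dart := by
        have h := hdart v
        have h' := hdeg v
        obtain ⟨d⟩ := Finite.card_pos_iff.1 (by omega : 0 < Nat.card {d : G.Dart // d.fst = v})
        exact ⟨d.1⟩
      have h1 := N.card_edgeSet_add_two_le
      rcases hr with rfl | ⟨rfl, c, hc⟩
      · have h2 := N.three_mul_card_face_le
        omega
      · have h2 := N.four_mul_card_face_le hc
        omega
    · push Not at hdeg
      obtain ⟨v, hv⟩ := hdeg
      have hE : Nat.card G.edgeSet ≤ Nat.card (G.induce {v}ᶜ).edgeSet + 1 := by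
        have h1 := G.card_edgeFinset_induce_compl_singleton v
        have h2 := G.card_edgeFinset_deleteIncidenceSet v
        rw [SimpleGraph.edgeFinset_card, SimpleGraph.edgeFinset_card] at h1
        rw [SimpleGraph.edgeFinset_card, SimpleGraph.edgeFinset_card] at h2
        simp only [Nat.card_eq_fintype_card]
        omega
      have hn' : Nat.card ({v}ᶜ : Set V) = n := by
        have := Set.ncard_compl ({v} : Set V)
        rw [Set.ncard_singleton] at this
        rw [Nat.card_coe_set_eq, this]
        omega
      rcases Nat.lt_or_ge n 3 with h3 | h3
      · have h4 : Nat.card (G.induce {v}ᶜ).edgeSet ≤ 1 := by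
          have := SimpleGraph.card_edgeFinset_le_card_choose_two (G := G.induce {v}ᶜ)
          rw [SimpleGraph.edgeFinset_card, ← Nat.card_eq_fintype_card,
            ← Nat.card_eq_fintype_card, hn'] at this
          obtain rfl : n = 2 := by omega
          simpa using this
        rw [← hn]
        rcases hr with rfl | ⟨rfl, -⟩ <;> omega
      · have := ih (G := G.induce {v}ᶜ)
          (D.ofCopy (SimpleGraph.Embedding.induce _).toCopy)
          (hr.imp id fun h => ⟨h.1, h.2.elim fun c hc => ⟨fun x => c x, fun x y hxy =>
            hc _ _ hxy⟩⟩) (by omega) hn'.symm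
        rw [hn'] at this
        rw [← hn]
        rcases hr with rfl | ⟨rfl, -⟩ <;> omega

/-- The same bounds for a subgraph `H` whose edges lie in a set `S` of vertices, with `S` in place
of the whole vertex set. -/
theorem card_edgeFinset_le_of_subset [Fintype V] (D : PlaneDrawing G) {H : SimpleGraph V}
    [Fintype H.edgeSet] (hHG : H ≤ G) {S : Finset V} (hS : ∀ u v, H.Adj u v → u ∈ S)
    (hcard : 3 ≤ S.card) {r : ℕ}
    (hr : r = 3 ∨ r = 2 ∧ ∃ c : V → Bool, ∀ u v, H.Adj u v → c u ≠ c v) :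
    H.edgeFinset.card + 2 * r ≤ r * S.card := by
  classical
  have h1 : (H.induce (S : Set V)).edgeFinset.card = H.edgeFinset.card := by
    convert SimpleGraph.card_edgeFinset_induce_of_support_subset (G := H) (s := (S : Set V)) ?_
    rintro u ⟨v, huv⟩
    exact hS u v huv
  have h2 := (D.ofCopy (((SimpleGraph.Copy.ofLE _ _ hHG)).comp
    (SimpleGraph.Embedding.induce (G := H) (S : Set V)).toCopy)).card_edgeSet_add_le (r := r)
    (hr.imp id fun h => ⟨h.1, h.2.elim fun c hc => ⟨fun x => c x, fun x y hxy => hc _ _ hxy⟩⟩)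
  have h3 : Nat.card (S : Set V) = S.card := by simp
  rw [h3, Nat.card_eq_fintype_card, ← SimpleGraph.edgeFinset_card, h1] at h2
  exact h2 hcard

end PlaneDrawing

/-! ### Plane graphs without a large matching -/

section Matching

variable {V : Type*} {H : SimpleGraph V}

theorem matchingGraph_isContained_iff {m : ℕ} : (matchingGraph m).IsContained H ↔
    ∃ f : Fin m × Bool → V, Function.Injective f ∧ ∀ i, H.Adj (f (i, false)) (f (i, true)) := by
  constructor
  · rintro ⟨f⟩
    exact ⟨f, f.injective, fun i => f.toHom.map_adj ⟨rfl, Bool.false_ne_true⟩⟩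
  · rintro ⟨f, hf, h⟩
    refine ⟨⟨⟨f, ?_⟩, hf⟩⟩
    rintro ⟨i, x⟩ ⟨j, y⟩ ⟨hij, hxy⟩
    dsimp only at hij hxy
    subst hij
    cases x <;> cases y
    · exact absurd rfl hxy
    · exact h i
    · exact (h i).symm
    · exact absurd rfl hxy

/-- A matching that misses both ends of an edge can be extended. -/
theorem matchingGraph_isContained_succ {m : ℕ} {f : Fin m × Bool → V} (hf : Function.Injective f)
    (h : ∀ i, H.Adj (f (i, false)) (f (i, true))) {p q : V} (hp : p ∉ Set.range f)
    (hq : q ∉ Set.range f) (hpq : H.Adj p q) : (matchingGraph (m + 1)).IsContained H := by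
  rw [matchingGraph_isContained_iff]
  refine ⟨fun x => Fin.cases (motive := fun _ => V) (if x.2 then q else p)
    (fun i => f (i, x.2)) x.1, ?_, fun i => ?_⟩
  · rintro ⟨i, x⟩ ⟨j, y⟩ hij
    induction i using Fin.cases with
    | zero =>
      induction j using Fin.cases with
      | zero => cases x <;> cases y <;> simp_all [hpq.ne, hpq.ne']
      | succ j =>
        cases x
        · exact absurd ⟨(j, y), Eq.symm hij⟩ hp
        · exact absurd ⟨(j, y), Eq.symm hij⟩ hq
    | succ i =>
      induction j using Fin.cases with
      | zero =>
        cases y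
        · exact absurd ⟨(i, x), hij⟩ hp
        · exact absurd ⟨(i, x), hij⟩ hq
      | succ j =>
        have := hf hij
        simp_all
  · induction i using Fin.cases with
    | zero => exact hpq
    | succ i => exact h i

theorem exists_maximal_matching {t : ℕ} (ht : ¬ (matchingGraph t).IsContained H) :
    ∃ m < t, (matchingGraph m).IsContained H ∧ ¬ (matchingGraph (m + 1)).IsContained H := by
  classical
  have h0 : (matchingGraph 0).IsContained H :=
    matchingGraph_isContained_iff.2 ⟨fun x => x.1.elim0, fun x => x.1.elim0, fun i => i.elim0⟩
  have hex : ∃ k, ¬ (matchingGraph k).IsContained H := ⟨t, ht⟩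
  have hpos : Nat.find hex ≠ 0 := fun h => Nat.find_spec hex (h ▸ h0)
  refine ⟨Nat.find hex - 1, ?_, ?_, ?_⟩
  · have := Nat.find_min' hex ht
    omega
  · by_contra h
    have := Nat.find_min' hex h
    omega
  · rw [Nat.sub_add_cancel (by omega)]
    exact Nat.find_spec hex

end Matching

open Classical in
/-- A plane graph on `n` vertices without `t` disjoint edges has at most `2n + 4t - 14` edges.
The vertices outside a maximum matching of size `m` are independent. If both ends of an edge of the
matching have neighbours outside, then they have just one, the same for both ends. So, if `b` edges
of the matching are of this kind, at most `2b + 2((m - b) + (n - 2m)) - 4` edges leave the matched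
vertices, and these span at most `6m - 6` edges. -/
theorem PlaneDrawing.card_edgeFinset_add_le_of_not_isContained {V : Type*} [Fintype V]
    {G H : SimpleGraph V} [Fintype H.edgeSet] (D : PlaneDrawing G) (hHG : H ≤ G) {t : ℕ}
    (ht : 6 ≤ t) (hn : 3 * t ≤ Fintype.card V + 6) (hM : ¬ (matchingGraph t).IsContained H) :
    H.edgeFinset.card + 14 ≤ 2 * Fintype.card V + 4 * t := by
  set n := Fintype.card V with hn'
  -- for few vertices the bound follows from `E ≤ 3V - 6`
  by_cases hn4 : n + 8 ≤ 4 * t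
  · have := D.card_edgeFinset_le_of_subset hHG (S := Finset.univ) (fun _ _ _ => Finset.mem_univ _)
      (by rw [Finset.card_univ]; omega) (.inl rfl)
    rw [Finset.card_univ] at this
    omega
  obtain ⟨m, hmt, hm, hm'⟩ := exists_maximal_matching hM
  obtain ⟨f, hf, hadj⟩ := matchingGraph_isContained_iff.1 hm
  set R : Finset V := Finset.univ.image f with hR
  have hRcard : R.card = 2 * m := by
    rw [hR, Finset.card_image_of_injective _ hf]
    simp [mul_comm]
  have hmemR : ∀ v, v ∈ R ↔ v ∈ Set.range f := by simp [hR]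
  have hIcard : Rᶜ.card = n - 2 * m := by rw [Finset.card_compl, hRcard]
  have hind : ∀ u v, u ∉ R → v ∉ R → ¬ H.Adj u v := fun u v hu hv huv =>
    hm' (matchingGraph_isContained_succ hf hadj (by rwa [← hmemR]) (by rwa [← hmemR]) huv)
  -- otherwise `a`, the edge `i` of the matching and `b` form an augmenting path
  have haug : ∀ i, ∀ a ∉ R, ∀ b ∉ R, H.Adj (f (i, false)) a → H.Adj (f (i, true)) b → a = b := by
    intro i a ha b hb hia hib
    by_contra hab
    have hval : ∀ x, Function.update f (i, true) a x = a ∨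
        x ≠ (i, true) ∧ Function.update f (i, true) a x = f x := by
      intro x
      by_cases hx : x = (i, true)
      · left; rw [hx, Function.update_self]
      · right; exact ⟨hx, Function.update_of_ne hx _ _⟩
    refine hm' (matchingGraph_isContained_succ (f := Function.update f (i, true) a) ?_ ?_
      (p := f (i, true)) (q := b) ?_ ?_ hib)
    · intro x y hxy
      by_cases hx : x = (i, true) <;> by_cases hy : y = (i, true)
      · rw [hx, hy]
      · rw [hx, Function.update_self, Function.update_of_ne hy] at hxy
        exact absurd ((hmemR a).2 ⟨y, hxy.symm⟩) ha
      · rw [hy, Function.update_self, Function.update_of_ne hx] at hxy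
        exact absurd ((hmemR a).2 ⟨x, hxy⟩) ha
      · rw [Function.update_of_ne hx, Function.update_of_ne hy] at hxy
        exact hf hxy
    · intro j
      rw [Function.update_of_ne (by simp)]
      by_cases hj : j = i
      · rw [hj, Function.update_self]
        exact hia
      · rw [Function.update_of_ne (by simpa using hj)]
        exact hadj j
    · rintro ⟨x, hx⟩
      rcases hval x with h | ⟨h, h'⟩
      · exact ha ((hmemR a).2 ⟨_, hx.symm.trans h⟩)
      · exact h (hf (h'.symm.trans hx))
    · rintro ⟨x, hx⟩
      rcases hval x with h | ⟨h, h'⟩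
      · exact hab (h.symm.trans hx)
      · exact hb ((hmemR b).2 ⟨x, h'.symm.trans hx⟩)
  -- the edges of the matching both of whose ends have neighbours outside
  set B : Finset (Fin m) := Finset.univ.filter fun i =>
    (∃ a ∉ R, H.Adj (f (i, false)) a) ∧ ∃ b ∉ R, H.Adj (f (i, true)) b with hB
  have hw : ∀ i, ∃ w, i ∈ B → ∀ o, ∀ a ∉ R, H.Adj (f (i, o)) a → a = w := by
    intro i
    by_cases hi : i ∈ B
    · obtain ⟨⟨a, ha, hia⟩, b, hb, hib⟩ := (Finset.mem_filter.1 hi).2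
      obtain rfl := haug i a ha b hb hia hib
      refine ⟨a, fun _ o c hc hic => ?_⟩
      cases o
      · exact haug i c hc a ha hic hib
      · exact (haug i a ha c hc hia hic).symm
    · exact ⟨f (i, false), fun h => absurd h hi⟩
  choose w hw using hw
  -- `g i` is the end of `i` that may have several neighbours outside
  set g : Fin m → V := fun i => if ∃ b ∉ R, H.Adj (f (i, true)) b then f (i, true)
    else f (i, false) with hg
  have hg' : ∀ i ∉ B, ∀ o, ∀ a ∉ R, H.Adj (f (i, o)) a → f (i, o) = g i := by
    intro i hi o a ha hia
    have hi : ¬ ((∃ a ∉ R, H.Adj (f (i, false)) a) ∧ ∃ b ∉ R, H.Adj (f (i, true)) b) :=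
      fun h => hi (Finset.mem_filter.2 ⟨Finset.mem_univ _, h⟩)
    simp only [hg]
    cases o
    · rw [if_neg fun h => hi ⟨⟨a, ha, hia⟩, h⟩]
    · rw [if_pos ⟨a, ha, hia⟩]
  set A : Finset V := Bᶜ.image g with hA
  have hAR : A ⊆ R := by
    intro v hv
    obtain ⟨i, -, rfl⟩ := Finset.mem_image.1 hv
    rw [hmemR]
    simp only [hg]
    split_ifs <;> exact ⟨_, rfl⟩
  have hAcard : A.card ≤ m - B.card := by
    refine Finset.card_image_le.trans ?_
    rw [Finset.card_compl, Fintype.card_fin]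
  have hBcard : B.card ≤ m := by simpa using Finset.card_le_univ B
  let H₁ : SimpleGraph V :=
    { Adj := fun u v => H.Adj u v ∧ u ∈ R ∧ v ∈ R
      symm := ⟨fun u v h => ⟨h.1.symm, h.2.2, h.2.1⟩⟩
      loopless := ⟨fun u h => H.ne_of_adj h.1 rfl⟩ }
  let H₂ : SimpleGraph V :=
    { Adj := fun u v => H.Adj u v ∧ (u ∈ A ∧ v ∉ R ∨ u ∉ R ∧ v ∈ A)
      symm := ⟨fun u v h => ⟨h.1.symm, h.2.symm.imp And.symm And.symm⟩⟩
      loopless := ⟨fun u h => H.ne_of_adj h.1 rfl⟩ }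
  let X : Finset (Sym2 V) := B.biUnion fun i => {s(f (i, false), w i), s(f (i, true), w i)}
  have hcover : H.edgeFinset ⊆ H₁.edgeFinset ∪ H₂.edgeFinset ∪ X := by
    have hone : ∀ u ∈ R, ∀ v ∉ R, H.Adj u v → s(u, v) ∈ H₂.edgeFinset ∪ X := by
      intro u hu v hv huv
      obtain ⟨⟨i, o⟩, rfl⟩ := (hmemR u).1 hu
      rw [Finset.mem_union]
      by_cases hi : i ∈ B
      · right
        refine Finset.mem_biUnion.2 ⟨i, hi, ?_⟩
        rw [← hw i hi o v hv huv]
        cases o <;> simp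
      · left
        rw [SimpleGraph.mem_edgeFinset]
        refine ⟨huv, .inl ⟨?_, hv⟩⟩
        rw [hg' i hi o v hv huv]
        exact Finset.mem_image_of_mem g (Finset.mem_compl.2 hi)
    intro e he
    rw [SimpleGraph.mem_edgeFinset] at he
    induction e with | _ u v
    have he : H.Adj u v := he
    rw [Finset.union_assoc, Finset.mem_union]
    by_cases hu : u ∈ R <;> by_cases hv : v ∈ R
    · left
      rw [SimpleGraph.mem_edgeFinset]
      exact ⟨he, hu, hv⟩
    · exact .inr (hone u hu v hv he)
    · right
      rw [Sym2.eq_swap]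
      exact hone v hv u hu he.symm
    · exact absurd he (hind u v hu hv)
  have hXcard : X.card ≤ 2 * B.card := by
    rw [mul_comm]
    exact Finset.card_biUnion_le_card_mul _ _ _ fun i _ => Finset.card_le_two
  have hsum : H.edgeFinset.card ≤ H₁.edgeFinset.card + H₂.edgeFinset.card + X.card :=
    (Finset.card_le_card hcover).trans ((Finset.card_union_le _ _).trans
      (Nat.add_le_add_right (Finset.card_union_le _ _) _))
  -- `S₁` has three vertices also if `m ≤ 1`, as `E ≤ 3V - 6` requires
  obtain ⟨S₁, hS₁, hS₁card⟩ := Finset.exists_superset_card_eq (s := R) (n := max (2 * m) 3)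
    (by omega) (by omega)
  have h₁ := D.card_edgeFinset_le_of_subset (H := H₁) (fun u v h => hHG h.1) (S := S₁)
    (fun u v h => hS₁ h.2.1) (by omega) (.inl rfl)
  have hS₂card : (A ∪ Rᶜ).card = A.card + Rᶜ.card :=
    Finset.card_union_of_disjoint (Finset.disjoint_left.2 fun v hv hv' =>
      Finset.mem_compl.1 hv' (hAR hv))
  have h₂ := D.card_edgeFinset_le_of_subset (H := H₂) (fun u v h => hHG h.1) (S := A ∪ Rᶜ)
    (fun u v h => by
      rcases h.2 with h | h
      · exact Finset.mem_union_left _ h.1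
      · exact Finset.mem_union_right _ (Finset.mem_compl.2 h.1)) (by omega) (r := 2)
    (.inr ⟨rfl, fun u => decide (u ∈ R), fun u v h => by
      rcases h.2 with ⟨h, h'⟩ | ⟨h, h'⟩
      · simp [hAR h, h']
      · simp [hAR h', h]⟩)
  omega

open Classical in
/-- The upper bound: the graph formed by one edge of each colour contains no `M_t`. -/
theorem le_of_mem_planarAntiRamseyColors {t n k : ℕ} (ht : 6 ≤ t) (hn : 3 * t ≤ n + 6)
    (hk : k ∈ planarAntiRamseyColors n (matchingGraph t)) : k + 14 ≤ 2 * n + 4 * t := by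
  obtain ⟨T, -, c, hc, hrain⟩ := hk
  -- one edge of each colour
  choose r hr using hc
  have hrinj : Function.Injective r := fun i j h => by rw [← hr i, ← hr j, h]
  set E : Finset (Sym2 (Fin n)) := Finset.univ.image fun i => (r i).1 with hE
  have hET : ∀ e ∈ E, e ∈ T.graph.edgeSet := by
    intro e he
    obtain ⟨i, -, rfl⟩ := Finset.mem_image.1 he
    exact (r i).2
  set H : SimpleGraph (Fin n) := SimpleGraph.fromEdgeSet E with hH
  have hHT : H ≤ T.graph := fun u v h => hET _ ((SimpleGraph.fromEdgeSet_adj _).1 h).1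
  have hcard : H.edgeFinset.card = k := by
    have : H.edgeFinset = E := by
      ext e
      rw [SimpleGraph.mem_edgeFinset, hH, SimpleGraph.edgeSet_fromEdgeSet]
      refine ⟨fun h => h.1, fun h => ⟨h, fun h' => ?_⟩⟩
      exact T.graph.not_isDiag_of_mem_edgeSet (hET e h) h'
    rw [this, hE, Finset.card_image_of_injective _ (fun i j h => hrinj (Subtype.ext h))]
    simp
  have hHE : ∀ e ∈ H.edgeSet, e ∈ E := fun e he => by
    rw [hH, SimpleGraph.edgeSet_fromEdgeSet] at he
    exact he.1
  have hM : ¬ (matchingGraph t).IsContained H := by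
    rintro ⟨f⟩
    refine hrain ⟨(SimpleGraph.Copy.ofLE _ _ hHT).comp f, fun e e' hee' => ?_⟩
    set F := ((SimpleGraph.Copy.ofLE _ _ hHT).comp f) with hF
    have himg : ∀ e : (matchingGraph t).edgeSet, ∃ i, r i = F.mapEdgeSet e := by
      intro e
      have h1 : (f.mapEdgeSet e).1 ∈ E := hHE _ (f.mapEdgeSet e).2
      obtain ⟨i, -, hi⟩ := Finset.mem_image.1 h1
      refine ⟨i, Subtype.ext (hi.trans ?_)⟩
      obtain ⟨e, he⟩ := e
      induction e with | _ u v
      rfl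
    obtain ⟨i, hi⟩ := himg e
    obtain ⟨j, hj⟩ := himg e'
    have hee' : c (F.mapEdgeSet e) = c (F.mapEdgeSet e') := hee'
    rw [← hi, ← hj, hr, hr] at hee'
    rw [hee', hj] at hi
    exact F.mapEdgeSet.injective hi.symm
  have := T.drawing.card_edgeFinset_add_le_of_not_isContained hHT ht (by simpa using hn) hM
  rw [hcard] at this
  simpa using this

/-! ### Triangles in the plane -/

/-- Twice the signed area of the triangle `a b q`; positive if `q` lies to the left of the line
from `a` to `b`. -/
def signedArea (a b q : Plane) : ℝ := (b.1 - a.1) * (q.2 - a.2) - (b.2 - a.2) * (q.1 - a.1)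

/-- The interior of a triangle with vertices in anticlockwise order. -/
def openTriangle (x y z : Plane) : Set Plane :=
  {q | 0 < signedArea x y q ∧ 0 < signedArea y z q ∧ 0 < signedArea z x q}

/-- The closed triangle with vertices in anticlockwise order. -/
def closedTriangle (x y z : Plane) : Set Plane :=
  {q | 0 ≤ signedArea x y q ∧ 0 ≤ signedArea y z q ∧ 0 ≤ signedArea z x q}

/-- The boundary of a triangle. -/
def triangleSides (x y z : Plane) : Set Plane :=
  segment ℝ x y ∪ segment ℝ y z ∪ segment ℝ x z

theorem signedArea_rotate (a b q : Plane) : signedArea b q a = signedArea a b q := by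
  simp only [signedArea]; ring

theorem signedArea_swap (a b q : Plane) : signedArea b a q = -signedArea a b q := by
  simp only [signedArea]; ring

@[simp] theorem signedArea_left (a b : Plane) : signedArea a b a = 0 := by
  simp only [signedArea]; ring

@[simp] theorem signedArea_right (a b : Plane) : signedArea a b b = 0 := by
  simp only [signedArea]; ring

theorem signedArea_combo (a b : Plane) {s t : ℝ} (h : s + t = 1) (q r : Plane) :
    signedArea a b (s • q + t • r) = s * signedArea a b q + t * signedArea a b r := by
  obtain rfl : s = 1 - t := by linarith
  simp only [signedArea, Prod.fst_add, Prod.snd_add, Prod.smul_fst, Prod.smul_snd, smul_eq_mul]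
  ring

@[fun_prop] theorem continuous_signedArea (a b : Plane) : Continuous (signedArea a b) := by
  unfold signedArea; fun_prop

theorem openTriangle_rotate (x y z : Plane) : openTriangle y z x = openTriangle x y z := by
  ext q; simp only [openTriangle, Set.mem_ofPred_eq]; tauto

theorem isOpen_openTriangle (x y z : Plane) : IsOpen (openTriangle x y z) := by
  refine (isOpen_lt continuous_const (continuous_signedArea x y)).inter
    ((isOpen_lt continuous_const (continuous_signedArea y z)).inter
      (isOpen_lt continuous_const (continuous_signedArea z x)))

theorem isClosed_closedTriangle (x y z : Plane) : IsClosed (closedTriangle x y z) := by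
  refine (isClosed_le continuous_const (continuous_signedArea x y)).inter
    ((isClosed_le continuous_const (continuous_signedArea y z)).inter
      (isClosed_le continuous_const (continuous_signedArea z x)))

theorem convex_signedArea_pos (a b : Plane) : Convex ℝ {q | 0 < signedArea a b q} := by
  intro q hq r hr s t hs ht hst
  simp only [Set.mem_ofPred_eq] at hq hr ⊢
  rw [signedArea_combo a b hst]
  rcases hs.eq_or_lt with rfl | hs
  · obtain rfl : t = 1 := by linarith
    simpa using hr
  · nlinarith [mul_pos hs hq, mul_nonneg ht hr.le]

theorem convex_signedArea_nonneg (a b : Plane) : Convex ℝ {q | 0 ≤ signedArea a b q} := by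
  intro q hq r hr s t hs ht hst
  simp only [Set.mem_ofPred_eq] at hq hr ⊢
  rw [signedArea_combo a b hst]
  positivity

theorem convex_openTriangle (x y z : Plane) : Convex ℝ (openTriangle x y z) :=
  (convex_signedArea_pos x y).inter ((convex_signedArea_pos y z).inter (convex_signedArea_pos z x))

theorem convex_closedTriangle (x y z : Plane) : Convex ℝ (closedTriangle x y z) :=
  (convex_signedArea_nonneg x y).inter
    ((convex_signedArea_nonneg y z).inter (convex_signedArea_nonneg z x))

/-- The centroid of three points. -/
noncomputable def centroid₃ (x y z : Plane) : Plane :=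
  ((x.1 + y.1 + z.1) / 3, (x.2 + y.2 + z.2) / 3)

section

variable {x y z : Plane}

theorem centroid₃_mem_openTriangle (h : 0 < signedArea x y z) :
    centroid₃ x y z ∈ openTriangle x y z := by
  have h1 : signedArea x y (centroid₃ x y z) = signedArea x y z / 3 := by
    simp only [signedArea, centroid₃]; ring
  have h2 : signedArea y z (centroid₃ x y z) = signedArea x y z / 3 := by
    simp only [signedArea, centroid₃]; ring
  have h3 : signedArea z x (centroid₃ x y z) = signedArea x y z / 3 := by
    simp only [signedArea, centroid₃]; ring
  refine ⟨?_, ?_, ?_⟩ <;> simp only [h1, h2, h3] <;> linarith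

theorem closure_openTriangle (h : 0 < signedArea x y z) :
    closure (openTriangle x y z) = closedTriangle x y z := by
  apply subset_antisymm
  · refine closure_minimal (fun q hq => ⟨hq.1.le, hq.2.1.le, hq.2.2.le⟩)
      (isClosed_closedTriangle x y z)
  · intro q hq
    have hc := centroid₃_mem_openTriangle h
    set c := centroid₃ x y z
    have hcont : Continuous fun s : ℝ => (1 - s) • q + s • c := by fun_prop
    have hlim : Tendsto (fun s : ℝ => (1 - s) • q + s • c) (𝓝[>] 0) (𝓝 q) := by
      have := (hcont.tendsto 0).mono_left (nhdsWithin_le_nhds (s := Set.Ioi 0))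
      simpa using this
    refine mem_closure_of_tendsto hlim ?_
    filter_upwards [Ioo_mem_nhdsGT (zero_lt_one' ℝ)] with s hs
    obtain ⟨hs0, hs1⟩ := hs
    obtain ⟨q1, q2, q3⟩ := hq
    obtain ⟨c1, c2, c3⟩ := hc
    have hst : (1 - s) + s = 1 := by ring
    have hs' : 0 ≤ 1 - s := by linarith
    refine ⟨?_, ?_, ?_⟩ <;> rw [signedArea_combo _ _ hst] <;>
      exact add_pos_of_nonneg_of_pos (mul_nonneg hs' (by assumption)) (mul_pos hs0 (by assumption))

theorem mem_segment_of_signedArea_eq_zero (h : 0 < signedArea x y z) {q : Plane}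
    (h0 : signedArea x y q = 0) (h1 : 0 ≤ signedArea y z q) (h2 : 0 ≤ signedArea z x q) :
    q ∈ segment ℝ x y := by
  have hsum : signedArea y z q + signedArea z x q = signedArea x y z := by
    rw [← add_zero (_ + _), ← h0]; simp only [signedArea]; ring
  refine ⟨signedArea y z q / signedArea x y z, signedArea z x q / signedArea x y z,
    div_nonneg h1 h.le, div_nonneg h2 h.le, by rw [← add_div, hsum, div_self h.ne'], ?_⟩
  have e1 : signedArea x y z * q.1 = signedArea y z q * x.1 + signedArea z x q * y.1 +
    signedArea x y q * z.1 := by simp only [signedArea]; ring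
  have e2 : signedArea x y z * q.2 = signedArea y z q * x.2 + signedArea z x q * y.2 +
    signedArea x y q * z.2 := by simp only [signedArea]; ring
  rw [h0] at e1 e2
  ext
  · simp only [Prod.fst_add, Prod.smul_fst, smul_eq_mul]
    field_simp
    linarith
  · simp only [Prod.snd_add, Prod.smul_snd, smul_eq_mul]
    field_simp
    linarith

theorem signedArea_eq_zero_of_mem_segment {a b q : Plane} (hq : q ∈ segment ℝ a b) :
    signedArea a b q = 0 := by
  obtain ⟨s, t, -, -, hst, rfl⟩ := hq
  rw [signedArea_combo a b hst]; simp

theorem notMem_openTriangle_of_mem_triangleSides {q : Plane} (hq : q ∈ triangleSides x y z) :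
    q ∉ openTriangle x y z := by
  rintro ⟨h1, h2, h3⟩
  rcases hq with (hq | hq) | hq
  · exact h1.ne' (signedArea_eq_zero_of_mem_segment hq)
  · exact h2.ne' (signedArea_eq_zero_of_mem_segment hq)
  · rw [segment_symm] at hq
    exact h3.ne' (signedArea_eq_zero_of_mem_segment hq)

theorem left_mem_closedTriangle (h : 0 < signedArea x y z) : x ∈ closedTriangle x y z := by
  refine ⟨by simp, ?_, by simp⟩
  rw [signedArea_rotate]; exact h.le

theorem mid_mem_closedTriangle (h : 0 < signedArea x y z) : y ∈ closedTriangle x y z := by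
  refine ⟨by simp, by simp, ?_⟩
  rw [← signedArea_rotate]; exact h.le

theorem right_mem_closedTriangle (h : 0 < signedArea x y z) :
    z ∈ closedTriangle x y z := ⟨h.le, by simp, by simp⟩

theorem closedTriangle_diff_openTriangle (h : 0 < signedArea x y z) :
    closedTriangle x y z \ openTriangle x y z = triangleSides x y z := by
  ext q
  constructor
  · rintro ⟨⟨h1, h2, h3⟩, hq⟩
    have hr : 0 < signedArea y z x := by rwa [signedArea_rotate]
    have hr' : 0 < signedArea z x y := by rwa [signedArea_rotate]
    rcases h1.eq_or_lt with e1 | e1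
    · exact .inl (.inl (mem_segment_of_signedArea_eq_zero h e1.symm h2 h3))
    rcases h2.eq_or_lt with e2 | e2
    · exact .inl (.inr (mem_segment_of_signedArea_eq_zero hr e2.symm h3 h1))
    rcases h3.eq_or_lt with e3 | e3
    · right
      rw [segment_symm]
      exact mem_segment_of_signedArea_eq_zero hr' e3.symm h1 h2
    · exact absurd ⟨e1, e2, e3⟩ hq
  · intro hq
    refine ⟨?_, notMem_openTriangle_of_mem_triangleSides hq⟩
    have hx := left_mem_closedTriangle h
    have hy := mid_mem_closedTriangle h
    have hz := right_mem_closedTriangle h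
    have hc := convex_closedTriangle x y z
    rcases hq with (hq | hq) | hq
    · exact hc.segment_subset hx hy hq
    · exact hc.segment_subset hy hz hq
    · exact hc.segment_subset hx hz hq

theorem frontier_openTriangle (h : 0 < signedArea x y z) :
    frontier (openTriangle x y z) = triangleSides x y z := by
  rw [(isOpen_openTriangle x y z).frontier_eq, closure_openTriangle h,
    closedTriangle_diff_openTriangle h]

theorem frontier_compl_closedTriangle (h : 0 < signedArea x y z) :
    frontier (closedTriangle x y z)ᶜ = triangleSides x y z := by
  have hne : (interior (openTriangle x y z)).Nonempty := by
    rw [(isOpen_openTriangle x y z).interior_eq]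
    exact ⟨_, centroid₃_mem_openTriangle h⟩
  rw [frontier_compl, (isClosed_closedTriangle x y z).frontier_eq,
    ← closedTriangle_diff_openTriangle h]
  congr 1
  rw [← closure_openTriangle h,
    (convex_openTriangle x y z).interior_closure_eq_interior_of_nonempty_interior hne,
    (isOpen_openTriangle x y z).interior_eq]

/-- The complement of a closed triangle is a union of three open half-planes, and consecutive
ones meet. -/
theorem isPreconnected_compl_closedTriangle (h : 0 < signedArea x y z) :
    IsPreconnected (closedTriangle x y z)ᶜ := by
  have hH : ∀ a b : Plane, IsPreconnected {q | signedArea a b q < 0} := by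
    intro a b
    have := (convex_signedArea_pos b a).isPreconnected
    simpa only [signedArea_swap a b, Left.neg_pos_iff] using this
  obtain ⟨c1, c2, c3⟩ := centroid₃_mem_openTriangle h
  set c := centroid₃ x y z
  -- the reflection of the centroid in a vertex lies beyond both sides that meet there
  have hmir : ∀ a b v : Plane, signedArea a b v = 0 → 0 < signedArea a b c →
      (2 : ℝ) • v + (-1 : ℝ) • c ∈ {q | signedArea a b q < 0} := by
    intro a b v hv hc
    rw [Set.mem_ofPred_eq]
    rw [signedArea_combo a b (by norm_num), hv]
    linarith
  have hunion : (closedTriangle x y z)ᶜ = {q | signedArea x y q < 0} ∪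
      {q | signedArea y z q < 0} ∪ {q | signedArea z x q < 0} := by
    ext q
    simp only [closedTriangle, Set.mem_compl_iff, Set.mem_ofPred_eq, Set.mem_union, not_and_or,
      not_le, or_assoc]
  rw [hunion]
  have h12 := (hH x y).union _ (hmir x y y (by simp) c1) (hmir y z y (by simp) c2) (hH y z)
  exact h12.union _ (.inr (hmir y z z (by simp) c2)) (hmir z x z (by simp) c3) (hH z x)

end

/-- A connected open set without boundary points in an ambient set is a component of it. -/
theorem connectedComponentIn_eq_of_disjoint_frontier {X : Type*} [TopologicalSpace X]
    {U C : Set X} {q : X} (hU : IsPreconnected U) (hUo : IsOpen U) (hUC : U ⊆ C) (hq : q ∈ U)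
    (hfr : Disjoint (frontier U) C) : connectedComponentIn C q = U := by
  apply subset_antisymm _ (hU.subset_connectedComponentIn hq hUC)
  refine isPreconnected_connectedComponentIn.subset_left_of_subset_union hUo
    isClosed_closure.isOpen_compl (disjoint_compl_right.mono_left subset_closure) (fun r hr => ?_)
    ⟨q, mem_connectedComponentIn (hUC hq), hq⟩
  by_cases hrU : r ∈ closure U
  · left
    by_contra h
    refine Set.disjoint_left.1 hfr ?_ (connectedComponentIn_subset _ _ hr)
    rw [hUo.frontier_eq]
    exact ⟨hrU, h⟩
  · exact .inr hrU

/-! ### Subdivision of a triangle by an interior point -/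

section Subdivision

variable {x y z c : Plane}

theorem openTriangle_subset_of_mem (hc : c ∈ openTriangle x y z) :
    openTriangle x y c ⊆ openTriangle x y z := by
  rintro q ⟨q1, q2, q3⟩
  obtain ⟨c1, c2, c3⟩ := hc
  have hsum : signedArea x y z = signedArea x y c + signedArea y z c + signedArea z x c := by
    simp only [signedArea]; ring
  have hD : 0 < signedArea x y z := by linarith
  refine ⟨q1, ?_, ?_⟩
  · have e : signedArea x y c * signedArea y z q =
        signedArea y c q * signedArea x y z + signedArea x y q * signedArea y z c := by
      simp only [signedArea]; ring
    exact pos_of_mul_pos_right (e ▸ by positivity : 0 < _ * signedArea y z q) c1.le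
  · have e : signedArea x y c * signedArea z x q =
        signedArea c x q * signedArea x y z + signedArea x y q * signedArea z x c := by
      simp only [signedArea]; ring
    exact pos_of_mul_pos_right (e ▸ by positivity : 0 < _ * signedArea z x q) c1.le

/-- A segment from an interior point to a point of the closed triangle is interior up to its end. -/
theorem segment_subset_openTriangle (hc : c ∈ openTriangle x y z) {v : Plane}
    (hv : v ∈ closedTriangle x y z) {q : Plane} (hq : q ∈ segment ℝ c v) :
    q = v ∨ q ∈ openTriangle x y z := by
  obtain ⟨s, t, hs, ht, hst, rfl⟩ := hq
  rcases hs.eq_or_lt with rfl | hs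
  · left
    obtain rfl : t = 1 := by linarith
    simp
  · right
    obtain ⟨c1, c2, c3⟩ := hc
    obtain ⟨v1, v2, v3⟩ := hv
    refine ⟨?_, ?_, ?_⟩ <;> rw [signedArea_combo _ _ hst] <;>
      exact add_pos_of_pos_of_nonneg (mul_pos hs (by assumption)) (mul_nonneg ht (by assumption))

theorem eq_of_mem_segments (h : signedArea x y c ≠ 0) {q : Plane} (hx : q ∈ segment ℝ c x)
    (hy : q ∈ segment ℝ c y) : q = c := by
  have h0 := signedArea_eq_zero_of_mem_segment hx
  obtain ⟨s, t, -, -, hst, rfl⟩ := hy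
  rw [signedArea_combo _ _ hst, signedArea_left, mul_zero, zero_add, mul_eq_zero,
    signedArea_rotate y c x, signedArea_rotate x y c] at h0
  obtain rfl := h0.resolve_right h
  obtain rfl : s = 1 := by linarith
  simp

theorem openTriangle_disjoint_of_common_side :
    Disjoint (openTriangle x y c) (openTriangle y z c) := by
  rw [Set.disjoint_left]
  rintro q ⟨-, h1, -⟩ ⟨-, -, h2⟩
  rw [signedArea_swap] at h2
  linarith

/-- A segment from an interior point to a vertex avoids the interior of the part on the side `x y`.
-/
theorem notMem_openTriangle_of_mem_segment (hc : c ∈ openTriangle x y z) {v : Plane}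
    (hv : v = x ∨ v = y ∨ v = z) {q : Plane} (hq : q ∈ segment ℝ c v) :
    q ∉ openTriangle x y c := by
  rintro ⟨h1, h2, h3⟩
  rcases hv with rfl | rfl | rfl
  · exact h3.ne' (signedArea_eq_zero_of_mem_segment hq)
  · rw [signedArea_swap, signedArea_eq_zero_of_mem_segment hq, neg_zero] at h2
    exact h2.false
  · obtain ⟨s, t, hs, ht, hst, rfl⟩ := hq
    rw [signedArea_combo _ _ hst, signedArea_right, mul_zero, zero_add] at h2
    have e : signedArea y c v = -signedArea y v c := by simp only [signedArea]; ring
    rw [e] at h2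
    nlinarith [mul_nonneg ht hc.2.1.le]

/-- The three segments from an interior point to the vertices cut the triangle into three parts. -/
theorem openTriangle_subdivision (hc : c ∈ openTriangle x y z) {q : Plane}
    (hq : q ∈ openTriangle x y z) (hx : q ∉ segment ℝ c x) (hy : q ∉ segment ℝ c y)
    (hz : q ∉ segment ℝ c z) :
    q ∈ openTriangle x y c ∨ q ∈ openTriangle y z c ∨ q ∈ openTriangle z x c := by
  obtain ⟨c1, c2, c3⟩ := hc
  obtain ⟨q1, q2, q3⟩ := hq
  have hsum : signedArea y z c * signedArea c x q + signedArea z x c * signedArea c y q +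
      signedArea x y c * signedArea c z q = 0 := by
    simp only [signedArea]; ring
  have key : ∀ v w : Plane, 0 < signedArea v w c → 0 < signedArea v w q → q ∉ segment ℝ c v →
      signedArea c v q = 0 → 0 < signedArea c w q := by
    intro v w hc hvw hseg h0
    by_contra hneg
    refine hseg (mem_segment_of_signedArea_eq_zero (z := w) ?_ h0 hvw.le ?_)
    · rwa [signedArea_rotate w c v, signedArea_rotate v w c]
    · rw [signedArea_swap]
      linarith
  have key₁ := key x y c1 q1 hx
  have key₂ := key y z c2 q2 hy
  have key₃ := key z x c3 q3 hz
  have case₂ : 0 < signedArea c y q → signedArea c z q < 0 → q ∈ openTriangle y z c :=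
    fun h h' => ⟨q2, by rw [signedArea_swap]; linarith, h⟩
  rcases lt_trichotomy (signedArea c x q) 0 with hX | hX | hX
  · rcases lt_trichotomy (signedArea c z q) 0 with hZ | hZ | hZ
    · refine .inr (.inl (case₂ ?_ hZ))
      by_contra h
      nlinarith [mul_pos c2 (neg_pos.2 hX), mul_pos c1 (neg_pos.2 hZ)]
    · exact absurd (key₃ hZ) hX.not_gt
    · exact .inr (.inr ⟨q3, by rw [signedArea_swap]; linarith, hZ⟩)
  · refine .inr (.inl (case₂ (key₁ hX) ?_))
    by_contra h
    have h' := key₁ hX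
    rw [hX] at hsum
    nlinarith [mul_pos c3 h', mul_nonneg c1.le (not_lt.1 h)]
  · rcases lt_trichotomy (signedArea c y q) 0 with hY | hY | hY
    · exact .inl ⟨q1, by rw [signedArea_swap]; linarith, hX⟩
    · have := key₂ hY
      rw [hY] at hsum
      nlinarith [mul_pos c2 hX, mul_pos c1 this]
    · refine .inr (.inl (case₂ hY ?_))
      by_contra h
      nlinarith [mul_pos c2 hX, mul_pos c3 hY, mul_nonneg c1.le (not_lt.1 h)]

end Subdivision

/-! ### Straight-line drawings built by inserting vertices into faces -/

/-- The open triangle spanned by three drawn vertices. -/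
def vertexTriangle (p : ℕ → Plane) (τ : ℕ × ℕ × ℕ) : Set Plane :=
  openTriangle (p τ.1) (p τ.2.1) (p τ.2.2)

/-- The straight-line drawing `p` of the subgraph of `G` on the vertices below `n` is a
triangulation of the triangle `0 1 2`, with the set `F` of inner faces. An edge is listed once, with
its larger end first. -/
structure StackedDrawing (G : SimpleGraph ℕ) (n : ℕ) (p : ℕ → Plane) (F : Set (ℕ × ℕ × ℕ)) :
    Prop where
  three_le : 3 ≤ n
  injective : ∀ u < n, ∀ v < n, p u = p v → u = v
  outer_pos : 0 < signedArea (p 0) (p 1) (p 2)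
  outer_adj : G.Adj 0 1 ∧ G.Adj 1 2 ∧ G.Adj 0 2
  mem_outer : ∀ v < n, p v ∈ closedTriangle (p 0) (p 1) (p 2)
  eq_end_of_mem : ∀ u < n, ∀ v < u, G.Adj u v → ∀ w < n, p w ∈ segment ℝ (p u) (p v) →
    w = u ∨ w = v
  common_end : ∀ u < n, ∀ v < u, G.Adj u v → ∀ u' < n, ∀ v' < u', G.Adj u' v' →
    (u, v) ≠ (u', v') → ∀ q ∈ segment ℝ (p u) (p v), q ∈ segment ℝ (p u') (p v') →
    ∃ w, (w = u ∨ w = v) ∧ (w = u' ∨ w = v') ∧ q = p w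
  face_lt : ∀ τ ∈ F, τ.1 < n ∧ τ.2.1 < n ∧ τ.2.2 < n
  face_adj : ∀ τ ∈ F, G.Adj τ.1 τ.2.1 ∧ G.Adj τ.2.1 τ.2.2 ∧ G.Adj τ.1 τ.2.2
  face_pos : ∀ τ ∈ F, 0 < signedArea (p τ.1) (p τ.2.1) (p τ.2.2)
  face_disjoint : ∀ τ ∈ F, ∀ τ' ∈ F, τ ≠ τ' →
    Disjoint (vertexTriangle p τ) (vertexTriangle p τ')
  vertex_notMem_face : ∀ τ ∈ F, ∀ v < n, p v ∉ vertexTriangle p τ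
  edge_disjoint_face : ∀ τ ∈ F, ∀ u < n, ∀ v < u, G.Adj u v →
    ∀ q ∈ segment ℝ (p u) (p v), q ∉ vertexTriangle p τ
  cover : ∀ q ∈ closedTriangle (p 0) (p 1) (p 2),
    (∃ u < n, ∃ v < u, G.Adj u v ∧ q ∈ segment ℝ (p u) (p v)) ∨ ∃ τ ∈ F, q ∈ vertexTriangle p τ

namespace StackedDrawing

variable {G : SimpleGraph ℕ} {n : ℕ} {p : ℕ → Plane} {F : Set (ℕ × ℕ × ℕ)}

/-- A single triangle is a stacked drawing. -/
theorem exists_triangle (h01 : G.Adj 0 1) (h12 : G.Adj 1 2) (h02 : G.Adj 0 2) :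
    ∃ p, StackedDrawing G 3 p {(0, 1, 2)} := by
  let p : ℕ → Plane := fun k => if k = 0 then (0, 0) else if k = 1 then (1, 0) else (0, 1)
  have p0 : p 0 = (0, 0) := rfl
  have p1 : p 1 = (1, 0) := rfl
  have p2 : p 2 = (0, 1) := rfl
  have hpos : 0 < signedArea (p 0) (p 1) (p 2) := by simp [signedArea, p0, p1, p2]
  have hpos' : 0 < signedArea (p 1) (p 2) (p 0) := by rwa [signedArea_rotate]
  have hpos'' : 0 < signedArea (p 2) (p 0) (p 1) := by rwa [signedArea_rotate]
  have hinj : ∀ u < 3, ∀ v < 3, p u = p v → u = v := by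
    intro u hu v hv h
    interval_cases u <;> interval_cases v <;> simp_all
  have hside : ∀ u < 3, ∀ v < u, ∀ q ∈ segment ℝ (p u) (p v), q ∈ triangleSides (p 0) (p 1) (p 2) ∧
      ∀ w < 3, w ≠ u → w ≠ v → q ≠ p w := by
    have hoff : ∀ a b c q : Plane, 0 < signedArea a b c → q ∈ segment ℝ a b → q ≠ c := by
      rintro a b c q habc hq rfl
      exact habc.ne' (signedArea_eq_zero_of_mem_segment hq)
    intro u hu v hv q hq
    interval_cases u <;> interval_cases v
    · rw [segment_symm] at hq
      refine ⟨.inl (.inl hq), fun w hw h1 h2 => ?_⟩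
      obtain rfl : w = 2 := by omega
      exact hoff _ _ _ _ hpos hq
    · refine ⟨.inr (by rwa [segment_symm]), fun w hw h1 h2 => ?_⟩
      obtain rfl : w = 1 := by omega
      exact hoff _ _ _ _ hpos'' hq
    · rw [segment_symm] at hq
      refine ⟨.inl (.inr hq), fun w hw h1 h2 => ?_⟩
      obtain rfl : w = 0 := by omega
      exact hoff _ _ _ _ hpos' hq
  refine ⟨p, ?_⟩
  constructor
  case three_le => exact le_rfl
  case injective => exact hinj
  case outer_pos => exact hpos
  case outer_adj => exact ⟨h01, h12, h02⟩
  case mem_outer =>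
    intro v hv
    interval_cases v
    exacts [left_mem_closedTriangle hpos, mid_mem_closedTriangle hpos,
      right_mem_closedTriangle hpos]
  case eq_end_of_mem =>
    intro u hu v hv _ w hw hq
    by_contra h
    push Not at h
    exact (hside u hu v hv _ hq).2 w hw h.1 h.2 rfl
  case common_end =>
    intro u hu v hv _ u' hu' v' hv' _ hne q hq hq'
    have key : ∀ a b c : Plane, 0 < signedArea a b c → q ∈ segment ℝ c a → q ∈ segment ℝ c b →
        q = c := fun a b c h h1 h2 => eq_of_mem_segments h.ne' h1 h2
    rw [Ne, Prod.mk.injEq, not_and] at hne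
    interval_cases u <;> interval_cases v <;> interval_cases u' <;> interval_cases v' <;>
      first
      | exact absurd rfl (hne rfl)
      | exact ⟨0, by omega, by omega, key (p 1) (p 2) (p 0) hpos' (by
          first | assumption | (rw [segment_symm]; assumption)) (by
          first | assumption | (rw [segment_symm]; assumption))⟩
      | exact ⟨1, by omega, by omega, key (p 2) (p 0) (p 1) hpos'' (by
          first | assumption | (rw [segment_symm]; assumption)) ‹_›⟩
      | exact ⟨2, by omega, by omega, key (p 0) (p 1) (p 2) hpos ‹_› ‹_›⟩
  case face_lt => rintro τ rfl; simp
  case face_adj => rintro τ rfl; exact ⟨h01, h12, h02⟩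
  case face_pos => rintro τ rfl; exact hpos
  case face_disjoint => rintro τ rfl τ' rfl h; exact absurd rfl h
  case vertex_notMem_face =>
    rintro τ rfl v hv ⟨h1, h2, h3⟩
    interval_cases v
    · simp at h1
    · simp at h1
    · simp at h2
  case edge_disjoint_face =>
    rintro τ rfl u hu v hv _ q hq
    exact notMem_openTriangle_of_mem_triangleSides (hside u hu v hv q hq).1
  case cover =>
    intro q hq
    by_cases hq' : q ∈ openTriangle (p 0) (p 1) (p 2)
    · exact .inr ⟨_, rfl, hq'⟩
    · left
      have : q ∈ triangleSides (p 0) (p 1) (p 2) := by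
        rw [← closedTriangle_diff_openTriangle hpos]
        exact ⟨hq, hq'⟩
      rcases this with (h | h) | h
      · exact ⟨1, by omega, 0, by omega, h01.symm, by rwa [segment_symm]⟩
      · exact ⟨2, by omega, 1, by omega, h12.symm, by rwa [segment_symm]⟩
      · exact ⟨2, by omega, 0, by omega, h02.symm, by rwa [segment_symm]⟩

/-- A new vertex may be placed inside a face and joined to the three vertices of the face. -/
theorem exists_insert (S : StackedDrawing G n p F) {a b c : ℕ} (hF : (a, b, c) ∈ F)
    (hadj : ∀ v < n, G.Adj n v ↔ v = a ∨ v = b ∨ v = c) :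
    ∃ p', StackedDrawing G (n + 1) p' (F \ {(a, b, c)} ∪ {(a, b, n), (b, c, n), (c, a, n)}) := by
  set o := centroid₃ (p a) (p b) (p c) with ho
  let p' : ℕ → Plane := Function.update p n o
  have hp'n : p' n = o := Function.update_self _ _ _
  have hp' : ∀ v, v < n → p' v = p v := fun v hv => Function.update_of_ne (by omega) _ _
  have hn := S.three_le
  obtain ⟨ha, hb, hc⟩ := S.face_lt _ hF
  dsimp only at ha hb hc
  obtain ⟨hab, hbc, hac⟩ := S.face_adj _ hF
  dsimp only at hab hbc hac
  have hpos : 0 < signedArea (p a) (p b) (p c) := S.face_pos _ hF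
  have hpos₂ : 0 < signedArea (p b) (p c) (p a) := by rwa [signedArea_rotate]
  have hpos₃ : 0 < signedArea (p c) (p a) (p b) := by rwa [signedArea_rotate]
  have hoT : o ∈ openTriangle (p a) (p b) (p c) := centroid₃_mem_openTriangle hpos
  have hoT₂ : o ∈ openTriangle (p b) (p c) (p a) := by rwa [openTriangle_rotate]
  have hoT₃ : o ∈ openTriangle (p c) (p a) (p b) := by
    rwa [openTriangle_rotate, openTriangle_rotate]
  have hmemT : ∀ v, (v = a ∨ v = b ∨ v = c) → p v ∈ closedTriangle (p a) (p b) (p c) := by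
    rintro v (rfl | rfl | rfl)
    exacts [left_mem_closedTriangle hpos, mid_mem_closedTriangle hpos,
      right_mem_closedTriangle hpos]
  -- a new edge lies in the open face, except for its old end
  have hnew : ∀ v, (v = a ∨ v = b ∨ v = c) → ∀ q ∈ segment ℝ o (p v),
      q = p v ∨ q ∈ vertexTriangle p (a, b, c) := fun v hv q hq =>
    segment_subset_openTriangle hoT (hmemT v hv) hq
  have hlt : ∀ v, (v = a ∨ v = b ∨ v = c) → v < n := by rintro v (rfl | rfl | rfl) <;> assumption
  have hnewnew : ∀ v, (v = a ∨ v = b ∨ v = c) → ∀ v', (v' = a ∨ v' = b ∨ v' = c) → v ≠ v' →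
      ∀ q ∈ segment ℝ o (p v), q ∈ segment ℝ o (p v') → q = o := by
    have e1 := hoT.1.ne'
    have e2 := hoT.2.1.ne'
    have e3 := hoT.2.2.ne'
    rintro v (rfl | rfl | rfl) v' (rfl | rfl | rfl) hne q hq hq'
    · exact absurd rfl hne
    · exact eq_of_mem_segments e1 hq hq'
    · exact eq_of_mem_segments e3 hq' hq
    · exact eq_of_mem_segments e1 hq' hq
    · exact absurd rfl hne
    · exact eq_of_mem_segments e2 hq hq'
    · exact eq_of_mem_segments e3 hq hq'
    · exact eq_of_mem_segments e2 hq' hq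
    · exact absurd rfl hne
  have hnewface : ∀ v, (v = a ∨ v = b ∨ v = c) → ∀ q ∈ segment ℝ o (p v),
      q ∉ openTriangle (p a) (p b) o ∧ q ∉ openTriangle (p b) (p c) o ∧
        q ∉ openTriangle (p c) (p a) o := by
    intro v hv q hq
    refine ⟨notMem_openTriangle_of_mem_segment hoT ?_ hq,
      notMem_openTriangle_of_mem_segment hoT₂ ?_ hq,
      notMem_openTriangle_of_mem_segment hoT₃ ?_ hq⟩ <;>
    rcases hv with rfl | rfl | rfl <;> simp
  have hold : ∀ τ ∈ F, vertexTriangle p' τ = vertexTriangle p τ := by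
    intro τ hτ
    obtain ⟨h1, h2, h3⟩ := S.face_lt τ hτ
    simp only [vertexTriangle, hp' _ h1, hp' _ h2, hp' _ h3]
  have hT₁ : vertexTriangle p' (a, b, n) = openTriangle (p a) (p b) o := by
    simp only [vertexTriangle, hp'n, hp' _ ha, hp' _ hb]
  have hT₂ : vertexTriangle p' (b, c, n) = openTriangle (p b) (p c) o := by
    simp only [vertexTriangle, hp'n, hp' _ hc, hp' _ hb]
  have hT₃ : vertexTriangle p' (c, a, n) = openTriangle (p c) (p a) o := by
    simp only [vertexTriangle, hp'n, hp' _ ha, hp' _ hc]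
  have hsub₁ : openTriangle (p a) (p b) o ⊆ vertexTriangle p (a, b, c) :=
    openTriangle_subset_of_mem hoT
  have hsub₂ : openTriangle (p b) (p c) o ⊆ vertexTriangle p (a, b, c) := by
    have := openTriangle_subset_of_mem hoT₂
    rwa [openTriangle_rotate (p a) (p b) (p c)] at this
  have hsub₃ : openTriangle (p c) (p a) o ⊆ vertexTriangle p (a, b, c) := by
    have := openTriangle_subset_of_mem hoT₃
    rwa [openTriangle_rotate (p b) (p c) (p a), openTriangle_rotate (p a) (p b) (p c)] at this
  have d₁₂ : Disjoint (openTriangle (p a) (p b) o) (openTriangle (p b) (p c) o) :=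
    openTriangle_disjoint_of_common_side
  have d₂₃ : Disjoint (openTriangle (p b) (p c) o) (openTriangle (p c) (p a) o) :=
    openTriangle_disjoint_of_common_side
  have d₃₁ : Disjoint (openTriangle (p c) (p a) o) (openTriangle (p a) (p b) o) :=
    openTriangle_disjoint_of_common_side
  -- the edges of the new drawing
  have hedge : ∀ u < n + 1, ∀ v < u, G.Adj u v →
      (u < n ∧ segment ℝ (p' u) (p' v) = segment ℝ (p u) (p v)) ∨
      (u = n ∧ (v = a ∨ v = b ∨ v = c) ∧ segment ℝ (p' u) (p' v) = segment ℝ o (p v)) := by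
    intro u hu v hv huv
    rcases Nat.lt_succ_iff_lt_or_eq.1 hu with hu | rfl
    · left
      rw [hp' u hu, hp' v (by omega)]
      exact ⟨hu, rfl⟩
    · right
      rw [hp'n, hp' v hv]
      exact ⟨rfl, (hadj v hv).1 huv, rfl⟩
  have hvert : ∀ v < n + 1, v < n ∧ p' v = p v ∨ v = n ∧ p' v = o := by
    intro v hv
    rcases Nat.lt_succ_iff_lt_or_eq.1 hv with hv | rfl
    · exact .inl ⟨hv, hp' v hv⟩
    · exact .inr ⟨rfl, hp'n⟩
  -- the faces of the new drawing
  have hface : ∀ τ ∈ F \ {(a, b, c)} ∪ {(a, b, n), (b, c, n), (c, a, n)},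
      τ ∈ F ∧ τ ≠ (a, b, c) ∨ τ = (a, b, n) ∨ τ = (b, c, n) ∨ τ = (c, a, n) := by
    intro τ hτ
    rcases hτ with hτ | hτ
    · exact .inl hτ
    · exact .inr hτ
  have ho' : o ∈ vertexTriangle p (a, b, c) := hoT
  have hcl : closedTriangle (p' 0) (p' 1) (p' 2) = closedTriangle (p 0) (p 1) (p 2) := by
    rw [hp' 0 (by omega), hp' 1 (by omega), hp' 2 (by omega)]
  refine ⟨p', ?_⟩
  constructor
  case three_le => omega
  case injective =>
    have hne : ∀ v < n, p v ≠ o := fun v hv h =>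
      S.vertex_notMem_face _ hF v hv (h ▸ ho')
    intro u hu v hv h
    rcases hvert u hu with ⟨hu, hu'⟩ | ⟨hu, hu'⟩ <;>
      rcases hvert v hv with ⟨hv, hv'⟩ | ⟨hv, hv'⟩
    · exact S.injective u hu v hv (hu' ▸ hv' ▸ h)
    · exact absurd (hu'.symm.trans (h.trans hv')) (hne u hu)
    · exact absurd (hv'.symm.trans (h.symm.trans hu')) (hne v hv)
    · exact hu.trans hv.symm
  case outer_pos =>
    rw [hp' 0 (by omega), hp' 1 (by omega), hp' 2 (by omega)]
    exact S.outer_pos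
  case outer_adj => exact S.outer_adj
  case mem_outer =>
    intro v hv
    rw [hcl]
    rcases hvert v hv with ⟨hv, hv'⟩ | ⟨hv, hv'⟩ <;> rw [hv']
    · exact S.mem_outer v hv
    · have hconv := convex_closedTriangle (p 0) (p 1) (p 2)
      have h1 := S.mem_outer a ha
      have h2 := S.mem_outer b hb
      have h3 := S.mem_outer c hc
      have h4 := hconv h1 h2 (by norm_num : (0 : ℝ) ≤ 1 / 2) (by norm_num : (0 : ℝ) ≤ 1 / 2)
        (by norm_num)
      have h5 := hconv h4 h3 (by norm_num : (0 : ℝ) ≤ 2 / 3) (by norm_num : (0 : ℝ) ≤ 1 / 3)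
        (by norm_num)
      convert h5 using 1
      rw [ho, centroid₃]
      ext <;> simp <;> ring
  case eq_end_of_mem =>
    intro u hu v hv huv w hw hq
    rcases hedge u hu v hv huv with ⟨hu, he⟩ | ⟨hu, hv', he⟩ <;> rw [he] at hq <;>
      rcases hvert w hw with ⟨hw, hw'⟩ | ⟨hw, hw'⟩ <;> rw [hw'] at hq
    · exact S.eq_end_of_mem u hu v hv huv w hw hq
    · exact absurd ho' (S.edge_disjoint_face _ hF u hu v hv huv _ hq)
    · rcases hnew v hv' _ hq with h | h
      · exact .inr (S.injective w hw v (hlt v hv') h)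
      · exact absurd h (S.vertex_notMem_face _ hF w hw)
    · exact .inl (hw.trans hu.symm)
  case common_end =>
    have hmix : ∀ u < n, ∀ v < u, G.Adj u v → ∀ v', (v' = a ∨ v' = b ∨ v' = c) →
        ∀ q ∈ segment ℝ (p u) (p v), q ∈ segment ℝ o (p v') →
        (v' = u ∨ v' = v) ∧ q = p' v' := by
      intro u hu v hv huv v' hv' q hq hq'
      rcases hnew v' hv' q hq' with rfl | h
      · exact ⟨S.eq_end_of_mem u hu v hv huv v' (hlt v' hv') hq, (hp' v' (hlt v' hv')).symm⟩
      · exact absurd h (S.edge_disjoint_face _ hF u hu v hv huv q hq)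
    intro u hu v hv huv u' hu' v' hv' huv' hne q hq hq'
    rcases hedge u hu v hv huv with ⟨hu, he⟩ | ⟨hu, hv1, he⟩ <;> rw [he] at hq <;>
      rcases hedge u' hu' v' hv' huv' with ⟨hu', he'⟩ | ⟨hu', hv1', he'⟩ <;> rw [he'] at hq'
    · obtain ⟨w, h1, h2, rfl⟩ := S.common_end u hu v hv huv u' hu' v' hv' huv' hne q hq hq'
      exact ⟨w, h1, h2, (hp' w (by omega)).symm⟩
    · obtain ⟨h1, h2⟩ := hmix u hu v hv huv v' hv1' q hq hq'
      exact ⟨v', h1, .inr rfl, h2⟩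
    · obtain ⟨h1, h2⟩ := hmix u' hu' v' hv' huv' v hv1 q hq' hq
      exact ⟨v, .inr rfl, h1, h2⟩
    · refine ⟨n, .inl hu.symm, .inl hu'.symm, ?_⟩
      rw [hp'n]
      exact hnewnew v hv1 v' hv1' (fun h => hne (by rw [hu, hu', h])) q hq hq'
  case face_lt =>
    intro τ hτ
    rcases hface τ hτ with ⟨h, -⟩ | rfl | rfl | rfl
    · obtain ⟨h1, h2, h3⟩ := S.face_lt τ h
      omega
    · exact ⟨by dsimp only; omega, by dsimp only; omega, by dsimp only; omega⟩
    · exact ⟨by dsimp only; omega, by dsimp only; omega, by dsimp only; omega⟩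
    · exact ⟨by dsimp only; omega, by dsimp only; omega, by dsimp only; omega⟩
  case face_adj =>
    have hna := (hadj a ha).2 (.inl rfl)
    have hnb := (hadj b hb).2 (.inr (.inl rfl))
    have hnc := (hadj c hc).2 (.inr (.inr rfl))
    intro τ hτ
    rcases hface τ hτ with ⟨h, -⟩ | rfl | rfl | rfl
    · exact S.face_adj τ h
    · exact ⟨hab, hnb.symm, hna.symm⟩
    · exact ⟨hbc, hnc.symm, hnb.symm⟩
    · exact ⟨hac.symm, hna.symm, hnc.symm⟩
  case face_pos =>
    intro τ hτ
    rcases hface τ hτ with ⟨h, -⟩ | rfl | rfl | rfl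
    · obtain ⟨h1, h2, h3⟩ := S.face_lt τ h
      rw [hp' _ h1, hp' _ h2, hp' _ h3]
      exact S.face_pos τ h
    · dsimp only
      rw [hp'n, hp' _ ha, hp' _ hb]
      exact hoT.1
    · dsimp only
      rw [hp'n, hp' _ hb, hp' _ hc]
      exact hoT.2.1
    · dsimp only
      rw [hp'n, hp' _ hc, hp' _ ha]
      exact hoT.2.2
  case face_disjoint =>
    have hmix : ∀ τ ∈ F, τ ≠ (a, b, c) → Disjoint (vertexTriangle p' τ)
        (vertexTriangle p (a, b, c)) := fun τ hτ hne => by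
      rw [hold τ hτ]
      exact S.face_disjoint τ hτ _ hF hne
    intro τ hτ τ' hτ' hne
    rcases hface τ hτ with ⟨h, h0⟩ | rfl | rfl | rfl <;>
      rcases hface τ' hτ' with ⟨h', h0'⟩ | rfl | rfl | rfl <;>
      (try rw [hT₁]) <;> (try rw [hT₂]) <;> (try rw [hT₃])
    · rw [hold τ h, hold τ' h']
      exact S.face_disjoint τ h τ' h' hne
    · exact (hmix τ h h0).mono_right hsub₁
    · exact (hmix τ h h0).mono_right hsub₂
    · exact (hmix τ h h0).mono_right hsub₃
    · exact ((hmix τ' h' h0').mono_right hsub₁).symm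
    · exact absurd rfl hne
    · exact d₁₂
    · exact d₃₁.symm
    · exact ((hmix τ' h' h0').mono_right hsub₂).symm
    · exact d₁₂.symm
    · exact absurd rfl hne
    · exact d₂₃
    · exact ((hmix τ' h' h0').mono_right hsub₃).symm
    · exact d₃₁
    · exact d₂₃.symm
    · exact absurd rfl hne
  case vertex_notMem_face =>
    intro τ hτ v hv
    rcases hvert v hv with ⟨hv, hv'⟩ | ⟨hv, hv'⟩ <;> rw [hv']
    · have hold' := S.vertex_notMem_face _ hF v hv
      rcases hface τ hτ with ⟨h, -⟩ | rfl | rfl | rfl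
      · rw [hold τ h]; exact S.vertex_notMem_face τ h v hv
      · rw [hT₁]; exact fun h => hold' (hsub₁ h)
      · rw [hT₂]; exact fun h => hold' (hsub₂ h)
      · rw [hT₃]; exact fun h => hold' (hsub₃ h)
    · have hself := hnewface a (.inl rfl) o (left_mem_segment _ _ _)
      rcases hface τ hτ with ⟨h, h0⟩ | rfl | rfl | rfl
      · rw [hold τ h]
        exact fun h' => Set.disjoint_left.1 (S.face_disjoint τ h _ hF h0) h' ho'
      · rw [hT₁]; exact hself.1
      · rw [hT₂]; exact hself.2.1
      · rw [hT₃]; exact hself.2.2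
  case edge_disjoint_face =>
    intro τ hτ u hu v hv huv q hq
    rcases hedge u hu v hv huv with ⟨hu, he⟩ | ⟨hu, hv1, he⟩ <;> rw [he] at hq
    · have hold' := S.edge_disjoint_face _ hF u hu v hv huv q hq
      rcases hface τ hτ with ⟨h, -⟩ | rfl | rfl | rfl
      · rw [hold τ h]; exact S.edge_disjoint_face τ h u hu v hv huv q hq
      · rw [hT₁]; exact fun h => hold' (hsub₁ h)
      · rw [hT₂]; exact fun h => hold' (hsub₂ h)
      · rw [hT₃]; exact fun h => hold' (hsub₃ h)
    · obtain ⟨h1, h2, h3⟩ := hnewface v hv1 q hq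
      rcases hface τ hτ with ⟨h, h0⟩ | rfl | rfl | rfl
      · rw [hold τ h]
        rcases hnew v hv1 q hq with rfl | h'
        · exact S.vertex_notMem_face τ h v (hlt v hv1)
        · exact fun h'' => Set.disjoint_left.1 (S.face_disjoint τ h _ hF h0) h'' h'
      · rwa [hT₁]
      · rwa [hT₂]
      · rwa [hT₃]
  case cover =>
    intro q hq
    rw [hcl] at hq
    rcases S.cover q hq with ⟨u, hu, v, hv, huv, h⟩ | ⟨τ, hτ, h⟩
    · exact .inl ⟨u, by omega, v, hv, huv, by rwa [hp' u hu, hp' v (by omega)]⟩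
    · by_cases hτ0 : τ = (a, b, c)
      · subst hτ0
        by_cases hs : ∃ v, (v = a ∨ v = b ∨ v = c) ∧ q ∈ segment ℝ o (p v)
        · obtain ⟨v, hv, hq⟩ := hs
          exact .inl ⟨n, by omega, v, hlt v hv, (hadj v (hlt v hv)).2 hv,
            by rwa [hp'n, hp' v (hlt v hv)]⟩
        · push Not at hs
          right
          rcases openTriangle_subdivision hoT h (hs a (.inl rfl)) (hs b (.inr (.inl rfl)))
            (hs c (.inr (.inr rfl))) with h | h | h
          · exact ⟨(a, b, n), by simp, by rwa [hT₁]⟩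
          · exact ⟨(b, c, n), by simp, by rwa [hT₂]⟩
          · exact ⟨(c, a, n), by simp, by rwa [hT₃]⟩
      · exact .inr ⟨τ, .inl ⟨hτ, hτ0⟩, by rwa [hold τ hτ]⟩

end StackedDrawing

/-! ### The plane triangulation of a stacked drawing -/

namespace StackedDrawing

variable {G : SimpleGraph ℕ} {n : ℕ} {p : ℕ → Plane} {F : Set (ℕ × ℕ × ℕ)}

/-- A nondegenerate segment is a polygonal arc. -/
theorem isPolygonalArc_segment {a b : Plane} (h : a ≠ b) : IsPolygonalArc (segment ℝ a b) a b := by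
  refine ⟨1, fun i => if i = 0 then a else b, le_rfl, rfl, rfl, ?_, ?_, ?_, ?_⟩
  · intro i hi
    obtain rfl : i = 0 := by omega
    simpa using h
  · intro i hi
    omega
  · intro i j hi hj
    omega
  · ext q
    simp

/-- The segment drawn for an edge. -/
def edgeSegment (p : ℕ → Plane) (n : ℕ) : Sym2 (Fin n) → Set Plane :=
  Sym2.lift ⟨fun u v => segment ℝ (p u) (p v), fun u v => segment_symm ℝ (p u) (p v)⟩

theorem exists_edge_eq (e : (G.comap (Fin.val : Fin n → ℕ)).edgeSet) :
    ∃ u v : Fin n, v < u ∧ G.Adj u v ∧ e.1 = s(u, v) ∧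
      edgeSegment p n e.1 = segment ℝ (p u) (p v) := by
  obtain ⟨e, he⟩ := e
  induction e with
  | _ u v =>
    have hadj : G.Adj u v := he
    rcases lt_trichotomy u v with h | h | h
    · exact ⟨v, u, h, hadj.symm, Sym2.eq_swap, segment_symm ℝ _ _⟩
    · exact absurd (h ▸ hadj) (G.loopless.irrefl _)
    · exact ⟨u, v, h, hadj, rfl, rfl⟩

/-- The plane drawing of the graph on the first `n` vertices. -/
def planeDrawing (S : StackedDrawing G n p F) : PlaneDrawing (G.comap (Fin.val : Fin n → ℕ)) where
  point v := p v
  arc e := edgeSegment p n e.1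
  point_injective u v h := Fin.ext (S.injective u u.2 v v.2 h)
  isPolygonalArc u v h := isPolygonalArc_segment fun h' =>
    h.ne (Fin.ext (S.injective u u.2 v v.2 h'))
  mem_of_point_mem_arc e x hx := by
    obtain ⟨u, v, hvu, hadj, he, hseg⟩ := exists_edge_eq (p := p) e
    rw [hseg] at hx
    rw [he, Sym2.mem_iff]
    exact (S.eq_end_of_mem u u.2 v hvu hadj x x.2 hx).imp Fin.ext Fin.ext
  common_end_of_mem_arcs e f hne q hq := by
    obtain ⟨u, v, hvu, hadj, he, hseg⟩ := exists_edge_eq (p := p) e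
    obtain ⟨u', v', hvu', hadj', he', hseg'⟩ := exists_edge_eq (p := p) f
    rw [hseg, hseg'] at hq
    obtain ⟨w, hw, hw', rfl⟩ := S.common_end u u.2 v hvu hadj u' u'.2 v' hvu' hadj' (fun h => by
      rw [Prod.mk.injEq] at h
      exact hne (Subtype.ext (by rw [he, he', Fin.ext h.1, Fin.ext h.2]))) q hq.1 hq.2
    have hwn : w < n := by
      rcases hw with rfl | rfl
      exacts [u.2, v.2]
    refine ⟨⟨w, hwn⟩, ?_, ?_, rfl⟩
    · rw [he, Sym2.mem_iff]
      exact hw.imp (fun h => Fin.ext h) (fun h => Fin.ext h)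
    · rw [he', Sym2.mem_iff]
      exact hw'.imp (fun h => Fin.ext h) (fun h => Fin.ext h)

theorem segment_subset_carrier (S : StackedDrawing G n p F) {u v : ℕ} (hu : u < n) (hv : v < n)
    (h : G.Adj u v) : segment ℝ (p u) (p v) ⊆ S.planeDrawing.carrier := fun _ hq =>
  .inr (Set.mem_iUnion.2 ⟨⟨s(⟨u, hu⟩, ⟨v, hv⟩), h⟩, hq⟩)

theorem carrier_subset_closedTriangle (S : StackedDrawing G n p F) :
    S.planeDrawing.carrier ⊆ closedTriangle (p 0) (p 1) (p 2) := by
  rintro q (⟨v, rfl⟩ | hq)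
  · exact S.mem_outer v v.2
  · obtain ⟨e, he⟩ := Set.mem_iUnion.1 hq
    obtain ⟨u, v, -, -, -, hseg⟩ := exists_edge_eq (p := p) e
    exact (convex_closedTriangle _ _ _).segment_subset (S.mem_outer u u.2) (S.mem_outer v v.2)
      (hseg ▸ he)

theorem disjoint_vertexTriangle_carrier (S : StackedDrawing G n p F) {τ : ℕ × ℕ × ℕ} (hτ : τ ∈ F) :
    Disjoint (vertexTriangle p τ) S.planeDrawing.carrier := by
  refine Set.disjoint_right.2 ?_
  rintro q (⟨v, rfl⟩ | hq)
  · exact S.vertex_notMem_face τ hτ v v.2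
  · obtain ⟨e, he⟩ := Set.mem_iUnion.1 hq
    obtain ⟨u, v, hvu, hadj, -, hseg⟩ := exists_edge_eq (p := p) e
    exact S.edge_disjoint_face τ hτ u u.2 v hvu hadj q (hseg ▸ he)

theorem triangleSides_subset_carrier (S : StackedDrawing G n p F) {x y z : ℕ} (hx : x < n)
    (hy : y < n) (hz : z < n) (hxy : G.Adj x y) (hyz : G.Adj y z) (hxz : G.Adj x z) :
    triangleSides (p x) (p y) (p z) ⊆ S.planeDrawing.carrier :=
  Set.union_subset (Set.union_subset (S.segment_subset_carrier hx hy hxy)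
    (S.segment_subset_carrier hy hz hyz)) (S.segment_subset_carrier hx hz hxz)

theorem isTriangulation (S : StackedDrawing G n p F) : S.planeDrawing.IsTriangulation := by
  -- it suffices that the face is an open connected set bounded by three sides
  have key : ∀ (U : Set Plane) (q : Plane) (x y z : ℕ), x < n → y < n → z < n → G.Adj x y →
      G.Adj y z → G.Adj x z → IsPreconnected U → IsOpen U → Disjoint U S.planeDrawing.carrier →
      q ∈ U → frontier U = triangleSides (p x) (p y) (p z) →
      ∃ (x y z : Fin n) (hxy : (G.comap Fin.val).Adj x y) (hyz : (G.comap Fin.val).Adj y z)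
        (hxz : (G.comap Fin.val).Adj x z),
        frontier (connectedComponentIn S.planeDrawing.carrierᶜ q) =
          S.planeDrawing.arc ⟨s(x, y), hxy⟩ ∪ S.planeDrawing.arc ⟨s(y, z), hyz⟩ ∪
            S.planeDrawing.arc ⟨s(x, z), hxz⟩ := by
    intro U q x y z hx hy hz hxy hyz hxz hU hUo hd hq hfr
    rw [connectedComponentIn_eq_of_disjoint_frontier hU hUo
      (Set.subset_compl_iff_disjoint_right.2 hd) hq (hfr ▸ Set.disjoint_compl_right_iff_subset.2
        (S.triangleSides_subset_carrier hx hy hz hxy hyz hxz)), hfr]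
    exact ⟨⟨x, hx⟩, ⟨y, hy⟩, ⟨z, hz⟩, hxy, hyz, hxz, rfl⟩
  have hn := S.three_le
  rintro _ ⟨q, hq, rfl⟩
  by_cases hqT : q ∈ closedTriangle (p 0) (p 1) (p 2)
  · rcases S.cover q hqT with ⟨u, hu, v, hv, huv, h⟩ | ⟨τ, hτ, h⟩
    · exact absurd (S.segment_subset_carrier hu (hv.trans hu) huv h) hq
    · obtain ⟨hx, hy, hz⟩ := S.face_lt τ hτ
      obtain ⟨hxy, hyz, hxz⟩ := S.face_adj τ hτ
      exact key _ q _ _ _ hx hy hz hxy hyz hxz (convex_openTriangle _ _ _).isPreconnected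
        (isOpen_openTriangle _ _ _) (S.disjoint_vertexTriangle_carrier hτ) h
        (frontier_openTriangle (S.face_pos τ hτ))
  · obtain ⟨h01, h12, h02⟩ := S.outer_adj
    exact key _ q 0 1 2 (by omega) (by omega) (by omega) h01 h12 h02
      (isPreconnected_compl_closedTriangle S.outer_pos) (isClosed_closedTriangle _ _ _).isOpen_compl
      (disjoint_compl_left.mono_right S.carrier_subset_closedTriangle) hqT
      (frontier_compl_closedTriangle S.outer_pos)

/-- The plane triangulation given by a stacked drawing. -/
def planeTriangulation (S : StackedDrawing G n p F) : PlaneTriangulation n where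
  graph := G.comap Fin.val
  drawing := S.planeDrawing
  isTriangulation := S.isTriangulation

end StackedDrawing

/-! ### The lower bound -/

/-- If `A` has at most `t - 2` vertices, the colouring that gives different colours to the edges
meeting `A` and one further colour to all other edges has no rainbow matching of size `t`. -/
theorem exists_edgeLabeling_not_hasRainbowCopy {V : Type*} (G : SimpleGraph V) (A : Finset V)
    {t K : ℕ} (hA : A.card + 2 ≤ t) (E : {e : G.edgeSet // ∃ v ∈ A, v ∈ e.1} ≃ Fin K)
    (e₀ : G.edgeSet) (he₀ : ∀ v ∈ A, v ∉ e₀.1) :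
    ∃ c : G.EdgeLabeling (Fin (K + 1)), Function.Surjective c ∧
      ¬ HasRainbowCopy (matchingGraph t) c := by
  classical
  let c : G.EdgeLabeling (Fin (K + 1)) := fun e =>
    if h : ∃ v ∈ A, v ∈ e.1 then (E ⟨e, h⟩).castSucc else Fin.last K
  have hlast : ∀ e : G.edgeSet, (¬ ∃ v ∈ A, v ∈ e.1) → c e = Fin.last K := fun e h => dif_neg h
  refine ⟨c, fun k => ?_, ?_⟩
  · refine Fin.lastCases ⟨e₀, hlast e₀ (by simpa using he₀)⟩ (fun j => ⟨(E.symm j).1, ?_⟩) k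
    have h : c (E.symm j).1 = (E ⟨(E.symm j).1, (E.symm j).2⟩).castSucc := dif_pos (E.symm j).2
    rw [h, Subtype.coe_eta, Equiv.apply_symm_apply]
  · rintro ⟨f, hf⟩
    let e : Fin t → (matchingGraph t).edgeSet := fun i =>
      ⟨s((i, false), (i, true)), rfl, Bool.false_ne_true⟩
    have he : ∀ i j, e i = e j → i = j := by
      intro i j h
      have h := congrArg Subtype.val h
      simpa [e] using h
    have hmem : ∀ i v, v ∈ (f.toHom.mapEdgeSet (e i)).1 ↔ v = f (i, false) ∨ v = f (i, true) :=
      fun i v => Sym2.mem_iff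
    let M : Fin t → Prop := fun i => ∃ v ∈ A, v ∈ (f.toHom.mapEdgeSet (e i)).1
    -- a rainbow matching has at most one edge that misses `A`
    have h1 : (Finset.univ.filter fun i => ¬ M i).card ≤ 1 := by
      refine Finset.card_le_one.2 fun i hi j hj => he i j (hf ?_)
      exact (hlast _ (Finset.mem_filter.1 hi).2).trans (hlast _ (Finset.mem_filter.1 hj).2).symm
    have h2 : (Finset.univ.filter M).card ≤ A.card := by
      have hM : ∀ i, ∃ v, M i → v ∈ A ∧ ∃ b, v = f (i, b) := by
        intro i
        by_cases h : M i
        · obtain ⟨v, hv, hv'⟩ := h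
          refine ⟨v, fun _ => ⟨hv, ?_⟩⟩
          rcases (hmem i v).1 hv' with h | h
          exacts [⟨_, h⟩, ⟨_, h⟩]
        · exact ⟨f (i, false), fun h' => absurd h' h⟩
      choose g hg using hM
      refine Finset.card_le_card_of_injOn g (fun i hi => (hg i (Finset.mem_filter.1 hi).2).1) ?_
      intro i hi j hj hij
      obtain ⟨b, hb⟩ := (hg i (Finset.mem_filter.1 hi).2).2
      obtain ⟨b', hb'⟩ := (hg j (Finset.mem_filter.1 hj).2).2
      exact congrArg Prod.fst (f.injective (hb.symm.trans (hij.trans hb')))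
    have h3 := Finset.card_filter_add_card_filter_not (s := (Finset.univ : Finset (Fin t))) M
    rw [Finset.card_univ, Fintype.card_fin] at h3
    omega

/-- The face into which the vertex `k ≥ 3` of the stacked graph is inserted. In each of the rounds
`k = 3r, 3r + 1, 3r + 2` with `1 ≤ r ≤ R + 1`, a vertex `3r` is put into the face `(0, 1, w)`, where
`w` is `2` or the vertex `3r - 3` of the previous round, and then a vertex into each of the two new
faces other than `(0, 1, 3r)`. From `3 R + 6` on, all vertices are put into the face at `0` and `1`.
For `k = 1, 2` the value is such that the smaller vertices are the earlier neighbours of `k`. -/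
def stackedFace (R k : ℕ) : ℕ × ℕ × ℕ :=
  if 3 ≤ k ∧ k ≤ 3 * R + 6 then
    if k % 3 = 0 then (0, 1, max 2 (k - 3))
    else if k % 3 = 1 then (1, max 2 (k - 4), k - 1)
    else (max 2 (k - 5), 0, k - 2)
  else (0, 1, k - 1)

/-- The vertex `v` is one of the at most three earlier neighbours of `u`. -/
def IsStackedParent (R v u : ℕ) : Prop :=
  v < u ∧ (v = (stackedFace R u).1 ∨ v = (stackedFace R u).2.1 ∨ v = (stackedFace R u).2.2)

/-- The graph in which the vertex `u ≥ 3` is joined to the vertices of the face `stackedFace R u`,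
and `0`, `1`, `2` form a triangle. -/
def stackedGraph (R : ℕ) : SimpleGraph ℕ where
  Adj u v := IsStackedParent R v u ∨ IsStackedParent R u v
  symm := ⟨fun _ _ h => h.symm⟩
  loopless := ⟨fun _ h => h.elim (fun h => h.1.false) (fun h => h.1.false)⟩

theorem stackedGraph_adj_iff_of_lt {R u v : ℕ} (h : v < u) : (stackedGraph R).Adj u v ↔
    v = (stackedFace R u).1 ∨ v = (stackedFace R u).2.1 ∨ v = (stackedFace R u).2.2 :=
  ⟨fun h' => h'.elim (fun h' => h'.2) (fun h' => absurd h'.1 (by omega)), fun h' => .inl ⟨h, h'⟩⟩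

/-- The stacked graph is drawn by successive insertions. The faces listed are those that later
insertions use. -/
theorem exists_stackedDrawing (R : ℕ) {n : ℕ} (hn : 3 ≤ n) : ∃ p F,
    StackedDrawing (stackedGraph R) n p F ∧
    (n ≤ 3 * R + 6 → n % 3 = 0 → (0, 1, max 2 (n - 3)) ∈ F) ∧
    (n ≤ 3 * R + 6 → n % 3 = 1 → (0, 1, n - 1) ∈ F ∧ (1, max 2 (n - 4), n - 1) ∈ F ∧
      (max 2 (n - 4), 0, n - 1) ∈ F) ∧
    (n ≤ 3 * R + 6 → n % 3 = 2 → (0, 1, n - 2) ∈ F ∧ (max 2 (n - 5), 0, n - 2) ∈ F) ∧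
    (3 * R + 6 < n → (0, 1, n - 1) ∈ F) := by
  induction n, hn using Nat.le_induction with
  | base =>
    obtain ⟨p, S⟩ := StackedDrawing.exists_triangle (G := stackedGraph R)
      (.inr ⟨by omega, by simp [stackedFace]⟩) (.inr ⟨by omega, by simp [stackedFace]⟩)
      (.inr ⟨by omega, by simp [stackedFace]⟩)
    exact ⟨p, _, S, by simp, by omega, by omega, by omega⟩
  | succ n hn ih =>
    obtain ⟨p, F, S, h0, h1, h2, h3⟩ := ih
    have hF : stackedFace R n ∈ F := by
      unfold stackedFace
      split_ifs with h h' h'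
      · exact h0 h.2 h'
      · exact (h1 h.2 h').2.1
      · exact (h2 h.2 (by omega)).2
      · exact h3 (by omega)
    obtain ⟨p', S'⟩ := S.exists_insert (a := (stackedFace R n).1) (b := (stackedFace R n).2.1)
      (c := (stackedFace R n).2.2) hF fun v hv => stackedGraph_adj_iff_of_lt hv
    refine ⟨p', _, S', ?_, ?_, ?_, ?_⟩
    · intro hR hm
      have h := (h2 (by omega) (by omega)).1
      refine .inl ⟨?_, ?_⟩
      · convert h using 3
        omega
      · simp only [stackedFace, Set.mem_singleton_iff, Prod.mk.injEq]
        rw [if_pos (by omega), if_neg (by omega), if_neg (by omega)]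
        simp only
        omega
    · intro hR hm
      have : stackedFace R n = (0, 1, max 2 (n - 3)) := by
        simp only [stackedFace]
        rw [if_pos (by omega), if_pos (by omega)]
      rw [this]
      simp only [Nat.add_sub_cancel, show n + 1 - 4 = n - 3 by omega]
      exact ⟨.inr (.inl rfl), .inr (.inr (.inl rfl)), .inr (.inr (.inr rfl))⟩
    · intro hR hm
      have : stackedFace R n = (1, max 2 (n - 4), n - 1) := by
        simp only [stackedFace]
        rw [if_pos (by omega), if_neg (by omega), if_pos (by omega)]
      obtain ⟨h, -, h'⟩ := h1 (by omega) (by omega)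
      rw [this]
      simp only [show n + 1 - 2 = n - 1 by omega, show n + 1 - 5 = n - 4 by omega]
      refine ⟨.inl ⟨h, ?_⟩, .inl ⟨h', ?_⟩⟩ <;> simp
      omega
    · intro hR
      have : stackedFace R n = (0, 1, (stackedFace R n).2.2) := by
        simp only [stackedFace]
        by_cases h : n ≤ 3 * R + 6
        · rw [if_pos (by omega), if_pos (by omega)]
        · rw [if_neg (by omega)]
      rw [this]
      exact .inr (.inl rfl)

/-- The core: the vertices `0` and `1` and the vertices `3 r` with `1 ≤ r ≤ R + 1`. The edges that
meet it will get different colours. -/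
def stackedCore (R : ℕ) : Finset ℕ :=
  insert 1 ((Finset.range (R + 2)).image (3 * ·))

theorem card_stackedCore_le (R : ℕ) : (stackedCore R).card ≤ R + 3 := by
  refine (Finset.card_insert_le _ _).trans ?_
  have := Finset.card_image_le (s := Finset.range (R + 2)) (f := (3 * ·))
  rw [Finset.card_range] at this
  omega

theorem mem_stackedCore {R v : ℕ} : v ∈ stackedCore R ↔ v = 1 ∨ v % 3 = 0 ∧ v ≤ 3 * R + 3 := by
  simp only [stackedCore, Finset.mem_insert, Finset.mem_image, Finset.mem_range]
  refine or_congr_right ⟨?_, fun h => ⟨v / 3, by omega, by omega⟩⟩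
  rintro ⟨a, ha, rfl⟩
  omega

/-- A lower bound for the number of earlier neighbours of `u` to which it is joined by an edge
meeting the core. -/
def coreDegree (R u : ℕ) : ℕ :=
  if u = 0 then 0 else if u = 1 then 1 else if u = 3 ∨ 6 ≤ u ∧ u ≤ 3 * R + 6 then 3 else 2

theorem sum_coreDegree (R : ℕ) {n : ℕ} (hn : 6 ≤ n) :
    ∑ u ∈ Finset.range n, coreDegree R u + 8 = 2 * n + min n (3 * R + 7) := by
  induction n, hn using Nat.le_induction with
  | base => simp [Finset.sum_range_succ, coreDegree]
  | succ n hn ih =>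
    rw [Finset.sum_range_succ]
    have : coreDegree R n = if n ≤ 3 * R + 6 then 3 else 2 := by
      unfold coreDegree
      split_ifs <;> omega
    rw [this]
    split_ifs <;> omega

theorem exists_card_eq_coreDegree (R u : ℕ) : ∃ s : Finset ℕ, s.card = coreDegree R u ∧
    ∀ v ∈ s, v < u ∧ (stackedGraph R).Adj u v ∧ (u ∈ stackedCore R ∨ v ∈ stackedCore R) := by
  have hs : ∃ s : Finset ℕ, s.card = coreDegree R u ∧ ∀ v ∈ s, v < u ∧
      (v = (stackedFace R u).1 ∨ v = (stackedFace R u).2.1 ∨ v = (stackedFace R u).2.2) ∧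
      (u ∈ stackedCore R ∨ v ∈ stackedCore R) := by
    have three : ∀ a b c : ℕ, a ≠ b → a ≠ c → b ≠ c → ({a, b, c} : Finset ℕ).card = 3 :=
      fun a b c h1 h2 h3 => Finset.card_eq_three.2 ⟨a, b, c, h1, h2, h3, rfl⟩
    by_cases h0 : u = 0
    · exact ⟨∅, by simp [coreDegree, h0], by simp⟩
    by_cases h1 : u = 1
    · exact ⟨{0}, by simp [coreDegree, h1], by simp [h1, stackedFace, mem_stackedCore]⟩
    by_cases h4 : u = 4
    · exact ⟨{1, 3}, by simp [coreDegree, h4], by simp [h4, stackedFace, mem_stackedCore]⟩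
    by_cases h5 : u = 5
    · exact ⟨{0, 3}, by simp [coreDegree, h5], by simp [h5, stackedFace, mem_stackedCore]⟩
    by_cases h2 : u = 2 ∨ 3 * R + 6 < u
    · refine ⟨{0, 1}, ?_, ?_⟩
      · unfold coreDegree
        rw [if_neg h0, if_neg h1, if_neg (by omega)]
        rfl
      · have : stackedFace R u = (0, 1, u - 1) := if_neg (by omega)
        intro v hv
        rw [Finset.mem_insert, Finset.mem_singleton] at hv
        rw [this, mem_stackedCore, mem_stackedCore]
        simp only
        omega
    · have h3 : coreDegree R u = 3 := by
        unfold coreDegree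
        rw [if_neg h0, if_neg h1, if_pos (by omega)]
      rw [h3]
      refine ⟨{(stackedFace R u).1, (stackedFace R u).2.1, (stackedFace R u).2.2}, ?_, ?_⟩
      · unfold stackedFace
        split_ifs <;> apply three <;> simp only <;> omega
      · intro v hv
        rw [Finset.mem_insert, Finset.mem_insert, Finset.mem_singleton] at hv
        refine ⟨?_, hv, ?_⟩
        · unfold stackedFace at hv
          split_ifs at hv <;> simp only at hv <;> omega
        · rw [mem_stackedCore, mem_stackedCore]
          unfold stackedFace at hv
          split_ifs at hv <;> simp only at hv <;> omega
  obtain ⟨s, hs, h⟩ := hs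
  exact ⟨s, hs, fun v hv => ⟨(h v hv).1, (stackedGraph_adj_iff_of_lt (h v hv).1).2 (h v hv).2.1,
    (h v hv).2.2⟩⟩

/-- At least `2n + 3R - 1` edges of the stacked graph meet the core. -/
theorem le_card_core_edges (R : ℕ) {n : ℕ} (hn : 3 * R + 7 ≤ n)
    [Fintype {e : ((stackedGraph R).comap (Fin.val : Fin n → ℕ)).edgeSet //
      ∃ v ∈ Finset.univ.filter (fun v : Fin n => v.val ∈ stackedCore R), v ∈ e.1}] :
    2 * n + 3 * R ≤ Fintype.card {e : ((stackedGraph R).comap (Fin.val : Fin n → ℕ)).edgeSet //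
      ∃ v ∈ Finset.univ.filter (fun v : Fin n => v.val ∈ stackedCore R), v ∈ e.1} + 1 := by
  choose s hs hsv using exists_card_eq_coreDegree R
  have hcard : ((Finset.range n).sigma s).card + 8 = 2 * n + (3 * R + 7) := by
    rw [Finset.card_sigma, Finset.sum_congr rfl fun u _ => hs u, sum_coreDegree R (by omega),
      min_eq_right hn]
  have hmem : ∀ x : (Finset.range n).sigma s, x.1.1 < n ∧ x.1.2 < x.1.1 ∧
      (stackedGraph R).Adj x.1.1 x.1.2 ∧ (x.1.1 ∈ stackedCore R ∨ x.1.2 ∈ stackedCore R) := by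
    intro x
    obtain ⟨h1, h2⟩ := Finset.mem_sigma.1 x.2
    exact ⟨Finset.mem_range.1 h1, hsv _ _ h2⟩
  have hle := Fintype.card_le_of_injective (β := {e : ((stackedGraph R).comap
      (Fin.val : Fin n → ℕ)).edgeSet // ∃ v ∈ Finset.univ.filter
        (fun v : Fin n => v.val ∈ stackedCore R), v ∈ e.1})
    (fun x : (Finset.range n).sigma s =>
      ⟨⟨s(⟨x.1.1, (hmem x).1⟩, ⟨x.1.2, (hmem x).2.1.trans (hmem x).1⟩), (hmem x).2.2.1⟩, by
        rcases (hmem x).2.2.2 with h | h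
        · exact ⟨_, Finset.mem_filter.2 ⟨Finset.mem_univ _, h⟩, Sym2.mem_mk_left _ _⟩
        · exact ⟨_, Finset.mem_filter.2 ⟨Finset.mem_univ _, h⟩, Sym2.mem_mk_right _ _⟩⟩)
    (fun x y h => by
      have h := congrArg (fun e => e.1.1) h
      have hx := (hmem x).2.1
      have hy := (hmem y).2.1
      simp only [Sym2.eq_iff, Fin.mk.injEq] at h
      have h' : x.1.1 = y.1.1 ∧ x.1.2 = y.1.2 := by omega
      exact Subtype.ext (Sigma.ext h'.1 (heq_of_eq h'.2)))
  rw [Fintype.card_coe] at hle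
  omega

theorem matchingGraph_isContained_stackedGraph {R n : ℕ} (hR : 1 ≤ R) (hn : 3 * R + 9 ≤ n) :
    (matchingGraph (R + 5)).IsContained ((stackedGraph R).comap (Fin.val : Fin n → ℕ)) := by
  -- the `i`-th edge of the matching joins `lo i` to the later vertex `up i`
  let lo : ℕ → ℕ := fun i => if i ≤ R then 3 * i + 3 else if i = R + 1 then 1 else
    if i = R + 2 then 0 else if i = R + 3 then 2 else 3 * R + 7
  let up : ℕ → ℕ := fun i => if i < R then 3 * i + 8 else if i = R then 3 * R + 6 else
    if i = R + 1 then 7 else if i = R + 2 then 5 else if i = R + 3 then 4 else 3 * R + 8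
  have hlo : ∀ i < R + 5, lo i < up i := by
    intro i hi
    simp only [lo, up]
    split_ifs <;> omega
  have hhi : ∀ i < R + 5, up i < n := by
    intro i hi
    simp only [up]
    split_ifs <;> omega
  have hlolo : ∀ i < R + 5, ∀ j < R + 5, lo i = lo j → i = j := by
    intro i hi j hj h
    simp only [lo] at h
    split_ifs at h <;> omega
  have hhihi : ∀ i < R + 5, ∀ j < R + 5, up i = up j → i = j := by
    intro i hi j hj h
    simp only [up] at h
    split_ifs at h <;> omega
  have hlohi : ∀ i < R + 5, ∀ j < R + 5, lo i ≠ up j := by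
    intro i hi j hj
    simp only [lo, up]
    split_ifs <;> omega
  have hadj : ∀ i < R + 5, (stackedGraph R).Adj (up i) (lo i) := by
    intro i hi
    rw [stackedGraph_adj_iff_of_lt (hlo i hi)]
    by_cases h : 3 * R + 6 < up i
    · have h0 : stackedFace R (up i) = (0, 1, up i - 1) := if_neg (by omega)
      rw [h0]
      simp only
      revert h
      simp only [lo, up]
      split_ifs <;> omega
    · have h4 : 4 ≤ up i := by
        simp only [up]
        split_ifs <;> omega
      simp only [stackedFace]
      rw [if_pos (by omega)]
      revert h
      simp only [lo, up]
      split_ifs <;> simp only [true_or, or_true, false_or, implies_true] <;> omega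
  refine matchingGraph_isContained_iff.2 ⟨fun x => if x.2 then ⟨up x.1, hhi _ x.1.2⟩ else
    ⟨lo x.1, (hlo _ x.1.2).trans (hhi _ x.1.2)⟩, ?_, fun i => ?_⟩
  · rintro ⟨i, b⟩ ⟨j, b'⟩ h
    cases b <;> cases b' <;> simp at h ⊢
    · exact Fin.ext (hlolo i i.2 j j.2 h)
    · exact hlohi i i.2 j j.2 h
    · exact hlohi j j.2 i i.2 h.symm
    · exact Fin.ext (hhihi i i.2 j j.2 h)
  · exact (hadj i i.2).symm

/-- The lower bound. The edge from `4` to `2` misses the core, so the further colour is used. -/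
theorem exists_mem_planarAntiRamseyColors {t n : ℕ} (ht : 6 ≤ t) (hn : 3 * t ≤ n + 6) :
    ∃ k ∈ planarAntiRamseyColors n (matchingGraph t), 2 * n + 3 * t ≤ k + 15 := by
  classical
  obtain ⟨R, rfl⟩ : ∃ R, t = R + 5 := ⟨t - 5, by omega⟩
  obtain ⟨p, F, S, -⟩ := exists_stackedDrawing R (n := n) (by omega)
  let A : Finset (Fin n) := Finset.univ.filter fun v => v.val ∈ stackedCore R
  have hA : A.card ≤ R + 3 :=
    (Finset.card_le_card_of_injOn Fin.val (fun v hv => (Finset.mem_filter.1 hv).2)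
      Fin.val_injective.injOn).trans (card_stackedCore_le R)
  have h42 : (stackedGraph R).Adj 4 2 :=
    (stackedGraph_adj_iff_of_lt (by omega)).2 (by simp [stackedFace])
  let e₀ : ((stackedGraph R).comap (Fin.val : Fin n → ℕ)).edgeSet :=
    ⟨s(⟨4, by omega⟩, ⟨2, by omega⟩), h42⟩
  have he₀ : ∀ v ∈ A, v ∉ e₀.1 := by
    intro v hv hv'
    have hv := mem_stackedCore.1 (Finset.mem_filter.1 hv).2
    rcases Sym2.mem_iff.1 hv' with rfl | rfl <;> simp at hv
  obtain ⟨c, hc, hc'⟩ := exists_edgeLabeling_not_hasRainbowCopy (t := R + 5)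
    ((stackedGraph R).comap (Fin.val : Fin n → ℕ)) A (by omega) (Fintype.equivFin _) e₀ he₀
  refine ⟨_, ⟨S.planeTriangulation,
    matchingGraph_isContained_stackedGraph (by omega) (by omega), c, hc, hc'⟩, ?_⟩
  have : 2 * n + 3 * R ≤ Fintype.card {e : ((stackedGraph R).comap
      (Fin.val : Fin n → ℕ)).edgeSet // ∃ v ∈ A, v ∈ e.1} + 1 := le_card_core_edges R (by omega)
  omega

theorem theorem3 (t n : ℕ) (ht : 6 ≤ t) (hn : 3 * (t : ℤ) - 6 ≤ (n : ℤ)) :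
    IsGreatest (planarAntiRamseyColors n (matchingGraph t))
        (planarAntiRamsey n (matchingGraph t)) ∧
      2 * (n : ℤ) + 3 * (t : ℤ) - 15 ≤ (planarAntiRamsey n (matchingGraph t) : ℤ) ∧
      (planarAntiRamsey n (matchingGraph t) : ℤ) ≤ 2 * (n : ℤ) + 4 * (t : ℤ) - 14 := by
  have hn' : 3 * t ≤ n + 6 := by omega
  obtain ⟨k, hk, hle⟩ := exists_mem_planarAntiRamseyColors ht hn'
  have hbdd : BddAbove (planarAntiRamseyColors n (matchingGraph t)) :=
    ⟨2 * n + 4 * t - 14, fun j hj => by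
      have := le_of_mem_planarAntiRamseyColors ht hn' hj
      omega⟩
  have hmem : planarAntiRamsey n (matchingGraph t) ∈ planarAntiRamseyColors n (matchingGraph t) :=
    Nat.sSup_mem ⟨k, hk⟩ hbdd
  have hge : k ≤ planarAntiRamsey n (matchingGraph t) := le_csSup hbdd hk
  have hup := le_of_mem_planarAntiRamseyColors ht hn' hmem
  exact ⟨⟨hmem, fun j hj => le_csSup hbdd hj⟩, by omega, by omega⟩
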